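/- Let $(\mathsf E,\otimes,\mathbb 1)$ be a symmetric monoidal category with finite coproducts such that, for every object $X$, the functor $X\otimes-$ preserves finite coproducts (for instance, a cocomplete closed symmetric monoidal category). Suppose that finite coproducts in $\mathsf E$ are disjoint and pullback-stable. That is: the coprojections of a binary coproduct are monomorphisms whose pullback is an initial object; pullbacks along coprojections exist; and for every morphism $Z\to X\sqcup Y$, the object $Z$ is the coproduct of its pullbacks along the coprojections of $X$ and $Y$. *Operads.* For tuples of colours $\underline c=(c_1,\dots,c_n)$, $\underline c'=(c'_1,\dots,c'_m)$ and $1\le i\le n$, let $\underline c\triangleleft_i\underline c'$ be the $(n+m-1)$-tuple obtained from $\underline c$ by replacing $c_i$ with the entries of $\underline c'$. A *planar enriched operad* $\mathcal P$ consists of a set of colours, objects $\mathcal P(\underline c;x)\in\mathsf E$ for every finite (possibly empty) tuple of colours $\underline c$ and every colour $x$, units $\mathbb 1\to\mathcal P(x;x)$ and partial compositions $$\gamma_i:\mathcal P(\underline c;x)\otimes\mathcal P(\underline c';c_i)\to\mathcal P(\underline c\triangleleft_i\underline c';x)$$ which satisfy the usual unit axioms and the sequential and parallel associativity axioms. An *enriched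 operad* has in addition right actions $\sigma^*:\mathcal P(\underline c;x)\to\mathcal P(\underline c^\sigma;x)$ for $\sigma\in S_n$, where $\underline c^\sigma=(c_{\sigma(1)},\dots,c_{\sigma(n)})$, for which the partial compositions are equivariant: $\gamma_i\circ(\sigma^*\otimes\mu^*)=(\sigma\triangleleft_i\mu)^*\circ\gamma_{\sigma(i)}$, where $\sigma\triangleleft_i\mu\in S_{n+m-1}$ is the block permutation which acts as $\mu$ from the inserted block at $i$ to the inserted block at $\sigma(i)$ and as $\sigma$ on the other entries. Morphisms consist of a map of colours and of compatible maps of objects of operations. *Hopf structure.* The category of enriched operads is monoidal for the Hadamard product, whose set of colours is $\mathrm{Ob}(\mathcal P)\times\mathrm{Ob}(\mathcal Q)$ and which is given by $$(\mathcal P\otimes_H\mathcal Q)\big(((c_j,d_j))_j;(x,y)\big)=\mathcal P(\underline c;x)\otimes\mathcal Q(\underline d;y).$$ Its unit $\mathrm{uCom}$ has one colour and $\mathrm{uCom}(n)=\mathbb 1$. The operad $\mathrm{uAs}$ has one colour and $\mathrm{uAs}(n)=\coprod_{\sigma\in S_n}\mathbb 1\otimes\{\sigma\}$, with $\mu^*\{\sigma\}=\{\sigma\mu\}$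 and $\gamma_i(\{\sigma\}\otimes\{\mu\})=\{\sigma\triangleleft_i\mu\}$. It is a comonoid for $\otimes_H$, with comultiplication $\{\sigma\}\mapsto\{\sigma\}\otimes\{\sigma\}$ and counit $\{\sigma\}\mapsto 1$. A *$\mathrm{uAs}$-comodule* is an enriched operad $\mathcal P$ with a morphism of operads $\mathcal P\to\mathcal P\otimes_H\mathrm{uAs}$ that is coassociative and counital; morphisms of comodules are the morphisms of operads which commute with the coactions. *Symmetrisation.* For a planar enriched operad $\mathcal P$, the enriched operad $\mathcal P_{\mathsf S}$ has the same colours as $\mathcal P$ and $$\mathcal P_{\mathsf S}(\underline c;x)=\coprod_{\sigma\in S_n}\mathcal P(\underline c^{\sigma^{-1}};x)\otimes\{\sigma\}.$$ The action of $\mu$ sends the summand $\sigma$ identically to the summand $\sigma\mu$; the composition $\gamma_i$ on the summands $\sigma$ and $\mu$ is $\gamma_{\sigma(i)}$ of $\mathcal P$, with values in the summand $\sigma\triangleleft_i\mu$; and the units are those of $\mathcal P$. It is a $\mathrm{uAs}$-comodule by means of $$\mathcal P(\underline c^{\sigma^{-1}};x)\otimes\{\sigma\}\to\mathcal P(\underline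 c^{\sigma^{-1}};x)\otimes\{\sigma\}\otimes\{\sigma\}\hookrightarrow\mathcal P_{\mathsf S}(\underline c;x)\otimes\mathrm{uAs}(n).$$ **Theorem.** The functor $\mathcal P\mapsto\mathcal P_{\mathsf S}$, from the category of planar enriched operads (with arbitrary, varying sets of colours) to the category of $\mathrm{uAs}$-comodules in enriched operads, is an equivalence of categories. -/

import Mathlib

open CategoryTheory MonoidalCategory Limits

universe w v u

set_option linter.unusedVariables false
set_option linter.unusedSectionVars false

namespace ColouredOperad

/-- The position in `Fin (n + m - 1)` of the entry `j ≠ i` of an `n`-tuple whose `i`-th entry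
has been replaced by an `m`-tuple. -/
def outer {n : ℕ} (i : Fin n) (m : ℕ) (j : Fin n) (h : j ≠ i) : Fin (n + m - 1) :=
  ⟨if j < i then j else j + m - 1, by
    have := j.2; have := i.2
    have h' : (j : ℕ) ≠ i := fun e => h (Fin.ext e)
    split_ifs with hj
    · have : (j : ℕ) < i := hj
      omega
    · have : ¬ (j : ℕ) < i := hj
      omega⟩

/-- The position in `Fin (n + m - 1)` of the `k`-th entry of an `m`-tuple which has been
substituted for the `i`-th entry of an `n`-tuple. -/
def inner {n m : ℕ} (i : Fin n) (k : Fin m) : Fin (n + m - 1) :=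
  ⟨i + k, by have := i.2; have := k.2; omega⟩

theorem outer_val {n : ℕ} (i : Fin n) (m : ℕ) (j : Fin n) (h : j ≠ i) :
    (outer i m j h : ℕ) = if (j : ℕ) < i then (j : ℕ) else j + m - 1 := rfl

theorem outer_lt {n : ℕ} (i : Fin n) (m : ℕ) (j : Fin n) (h : j ≠ i) (hj : (j : ℕ) < i) :
    (outer i m j h : ℕ) = j := if_pos hj

theorem outer_gt {n : ℕ} (i : Fin n) (m : ℕ) (j : Fin n) (h : j ≠ i) (hj : (i : ℕ) < j) :
    (outer i m j h : ℕ) = j + m - 1 := if_neg (Nat.lt_asymm hj)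

theorem inner_val {n m : ℕ} (i : Fin n) (k : Fin m) : (inner i k : ℕ) = i + k := rfl

/-- The bijection between `({0, …, n-1} ∖ {i}) ⊔ {0, …, m-1}` and `{0, …, n+m-2}`. -/
def slot {n : ℕ} (i : Fin n) (m : ℕ) : {j : Fin n // j ≠ i} ⊕ Fin m ≃ Fin (n + m - 1) where
  toFun := Sum.elim (fun j => outer i m j.1 j.2) (fun k => inner i k)
  invFun p :=
    if h₁ : (p : ℕ) < i then
      .inl ⟨⟨p, h₁.trans i.2⟩, fun e => h₁.ne (congrArg Fin.val e)⟩
    else if h₂ : (p : ℕ) < i + m then .inr ⟨p - i, by omega⟩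
    else .inl ⟨⟨p + 1 - m, by have := p.2; have := i.2; omega⟩, fun e => by
      have := congrArg Fin.val e
      simp only at this
      omega⟩
  left_inv := by
    rintro (⟨j, hj⟩ | k)
    · simp only [Sum.elim_inl]
      rcases Nat.lt_or_gt_of_ne (fun e => hj (Fin.ext e) : (j : ℕ) ≠ i) with hlt | hgt
      · have e := outer_lt i m j hj hlt
        exact (dif_pos (by omega)).trans (congrArg Sum.inl (Subtype.ext (Fin.ext e)))
      · have e := outer_gt i m j hj hgt
        exact (dif_neg (by omega)).trans ((dif_neg (by omega)).trans
          (congrArg Sum.inl (Subtype.ext (Fin.ext (by dsimp only; omega)))))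
    · simp only [Sum.elim_inr]
      have e := inner_val i k
      exact (dif_neg (by omega)).trans ((dif_pos (by omega)).trans
          (congrArg Sum.inr (Fin.ext (by dsimp only; omega))))
  right_inv := by
    intro p
    apply Fin.ext
    have := p.2
    have := i.2
    dsimp only
    split_ifs with h₁ h₂
    · simp only [Sum.elim_inl, outer_val]; split_ifs <;> omega
    · simp only [Sum.elim_inr, inner_val]; omega
    · simp only [Sum.elim_inl, outer_val]; split_ifs <;> omega

@[simp] theorem slot_symm_outer {n : ℕ} (i : Fin n) (m : ℕ) (j : Fin n) (h : j ≠ i) :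
    (slot i m).symm (outer i m j h) = .inl ⟨j, h⟩ :=
  (slot i m).symm_apply_apply (.inl ⟨j, h⟩)

@[simp] theorem slot_symm_inner {n m : ℕ} (i : Fin n) (k : Fin m) :
    (slot i m).symm (inner i k) = .inr k :=
  (slot i m).symm_apply_apply (.inr k)

theorem slot_cases {n m : ℕ} (i : Fin n) {p : Fin (n + m - 1) → Prop}
    (ho : ∀ j h, p (outer i m j h)) (hi : ∀ k, p (inner i k)) (q) : p q := by
  obtain ⟨(⟨j, h⟩ | k), rfl⟩ := (slot i m).surjective q
  · exact ho j h
  · exact hi k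

theorem outer_ne_outer {n : ℕ} {i : Fin n} {m : ℕ} {j k : Fin n} {hj : j ≠ i} {hk : k ≠ i}
    (h : j ≠ k) : outer i m j hj ≠ outer i m k hk := fun e => h (by
  have := (slot i m).injective (a₁ := .inl ⟨j, hj⟩) (a₂ := .inl ⟨k, hk⟩) e
  simpa using this)

theorem inner_ne_outer {n : ℕ} {i : Fin n} {m : ℕ} {j : Fin m} {k : Fin n} {hk : k ≠ i} :
    inner i j ≠ outer i m k hk := fun e => by
  have := (slot i m).injective (a₁ := .inr j) (a₂ := .inl ⟨k, hk⟩) e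
  simp at this

theorem inner_ne_inner {n : ℕ} {i : Fin n} {m : ℕ} {j k : Fin m} (h : j ≠ k) :
    inner i j ≠ inner i k := fun e => h (by
  have := (slot i m).injective (a₁ := .inr j) (a₂ := .inr k) e
  simpa using this)

theorem len_insert_inner {n m : ℕ} (i : Fin n) (j : Fin m) (l : ℕ) :
    n + m - 1 + l - 1 = n + (m + l - 1) - 1 := by
  have := i.2; have := j.2; omega

theorem len_insert_outer {n : ℕ} (i k : Fin n) (h : k ≠ i) (m l : ℕ) :
    n + m - 1 + l - 1 = n + l - 1 + m - 1 := by
  have := i.2; have := k.2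
  have : (k : ℕ) ≠ i := fun e => h (Fin.ext e)
  omega

theorem pos_inner_outer_val {n m l : ℕ} (i : Fin n) (j : Fin m) (a : Fin n) (ha : a ≠ i) (h) :
    (outer (inner i j) l (outer i m a ha) h : ℕ) =
      (outer i (m + l - 1) a ha : Fin (n + (m + l - 1) - 1)) := by
  have : (a : ℕ) ≠ i := fun e => ha (Fin.ext e)
  have := j.2
  simp only [outer_val, inner_val]
  split_ifs <;> omega

theorem pos_inner_outer {n m l : ℕ} (i : Fin n) (j : Fin m) (a : Fin n) (ha : a ≠ i) (h)
    {q : Fin (n + (m + l - 1) - 1)} (hq : (outer (inner i j) l (outer i m a ha) h : ℕ) = q) :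
    q = outer i (m + l - 1) a ha :=
  Fin.ext (hq.symm.trans (pos_inner_outer_val i j a ha h))

theorem pos_inner_inner_outer_val {n m l : ℕ} (i : Fin n) (j b : Fin m) (h) :
    (outer (inner i j) l (inner i b) h : ℕ) =
      (inner i (outer j l b fun e => h (congrArg _ e)) : Fin (n + (m + l - 1) - 1)) := by
  have : (b : ℕ) ≠ j := fun e => h (congrArg _ (Fin.ext e))
  rcases Nat.lt_or_gt_of_ne this with hb | hb
  · rw [outer_lt _ _ _ _ (by simp only [inner_val]; omega), inner_val, inner_val,
      outer_lt _ _ _ _ hb]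
  · rw [outer_gt _ _ _ _ (by simp only [inner_val]; omega), inner_val, inner_val,
      outer_gt _ _ _ _ hb]
    omega

theorem pos_inner_inner_outer {n m l : ℕ} (i : Fin n) (j b : Fin m) (h)
    {q : Fin (n + (m + l - 1) - 1)} (hq : (outer (inner i j) l (inner i b) h : ℕ) = q) :
    q = inner i (outer j l b fun e => h (congrArg _ e)) :=
  Fin.ext (hq.symm.trans (pos_inner_inner_outer_val i j b h))

theorem pos_inner_inner_val {n m l : ℕ} (i : Fin n) (j : Fin m) (k : Fin l) :
    (inner (inner i j) k : ℕ) =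
      (inner i (inner j k) : Fin (n + (m + l - 1) - 1)) := by
  simp only [inner_val]
  omega

theorem pos_inner_inner {n m l : ℕ} (i : Fin n) (j : Fin m) (k : Fin l)
    {q : Fin (n + (m + l - 1) - 1)} (hq : (inner (inner i j) k : ℕ) = q) :
    q = inner i (inner j k) :=
  Fin.ext (hq.symm.trans (pos_inner_inner_val i j k))

theorem pos_outer_outer_val {n m l : ℕ} (i k : Fin n) (h : k ≠ i) (a : Fin n) (ha : a ≠ i) (h') :
    (outer (outer i m k h) l (outer i m a ha) h' : ℕ) =
      (outer (outer k l i h.symm) m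
      (outer k l a fun e => h' (by subst e; rfl)) (outer_ne_outer ha) : Fin (n + l - 1 + m - 1)) := by
  have : (a : ℕ) ≠ i := fun e => ha (Fin.ext e)
  have : (k : ℕ) ≠ i := fun e => h (Fin.ext e)
  have : (a : ℕ) ≠ k := fun e => h' (by obtain rfl := Fin.ext e; rfl)
  simp only [outer_val]
  split_ifs <;> omega

theorem pos_outer_outer {n m l : ℕ} (i k : Fin n) (h : k ≠ i) (a : Fin n) (ha : a ≠ i) (h')
    {q : Fin (n + l - 1 + m - 1)} (hq : (outer (outer i m k h) l (outer i m a ha) h' : ℕ) = q) :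
    q = outer (outer k l i h.symm) m
      (outer k l a fun e => h' (by subst e; rfl)) (outer_ne_outer ha) :=
  Fin.ext (hq.symm.trans (pos_outer_outer_val i k h a ha h'))

theorem pos_outer_inner_val {n m l : ℕ} (i k : Fin n) (h : k ≠ i) (b : Fin m) (h') :
    (outer (outer i m k h) l (inner i b) h' : ℕ) =
      (inner (outer k l i h.symm) b : Fin (n + l - 1 + m - 1)) := by
  have : (k : ℕ) ≠ i := fun e => h (Fin.ext e)
  have := b.2
  simp only [outer_val, inner_val]
  split_ifs <;> omega

theorem pos_outer_inner {n m l : ℕ} (i k : Fin n) (h : k ≠ i) (b : Fin m) (h')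
    {q : Fin (n + l - 1 + m - 1)} (hq : (outer (outer i m k h) l (inner i b) h' : ℕ) = q) :
    q = inner (outer k l i h.symm) b :=
  Fin.ext (hq.symm.trans (pos_outer_inner_val i k h b h'))

theorem pos_outer_inner_val' {n m l : ℕ} (i k : Fin n) (h : k ≠ i) (b : Fin l) :
    (inner (outer i m k h) b : ℕ) =
      (outer (outer k l i h.symm) m (inner k b) inner_ne_outer : Fin (n + l - 1 + m - 1)) := by
  have : (k : ℕ) ≠ i := fun e => h (Fin.ext e)
  have := b.2
  simp only [outer_val, inner_val]
  split_ifs <;> omega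

theorem pos_outer_inner' {n m l : ℕ} (i k : Fin n) (h : k ≠ i) (b : Fin l)
    {q : Fin (n + l - 1 + m - 1)} (hq : (inner (outer i m k h) b : ℕ) = q) :
    q = outer (outer k l i h.symm) m (inner k b) inner_ne_outer :=
  Fin.ext (hq.symm.trans (pos_outer_inner_val' i k h b))

/-- The block permutation `σ ◁ᵢ μ`, which sends the entries of the `m`-tuple substituted for `i`
to those of the `m'`-tuple substituted for `σ i` by means of `μ`, and moves the other entries
by means of `σ`. -/
def blockPerm {n n' m m' : ℕ} (σ : Fin n ≃ Fin n') (i : Fin n) (μ : Fin m ≃ Fin m') :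
    Fin (n + m - 1) ≃ Fin (n' + m' - 1) :=
  (slot i m).symm.trans
    ((Equiv.sumCongr (σ.subtypeEquiv (q := fun j => j ≠ σ i)
      fun _ => σ.injective.ne_iff.symm) μ).trans (slot (σ i) m'))

theorem blockPerm_outer {n n' m m' : ℕ} (σ : Fin n ≃ Fin n') (i : Fin n)
    (μ : Fin m ≃ Fin m') (j : Fin n) (h : j ≠ i) :
    blockPerm σ i μ (outer i m j h) = outer (σ i) m' (σ j) (σ.injective.ne h) := by
  simp [blockPerm]; rfl

theorem blockPerm_inner {n n' m m' : ℕ} (σ : Fin n ≃ Fin n') (i : Fin n)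
    (μ : Fin m ≃ Fin m') (k : Fin m) :
    blockPerm σ i μ (inner i k) = inner (σ i) (μ k) := by
  simp [blockPerm]; rfl

theorem blockPerm_outer' {n n' m m' : ℕ} {σ : Fin n ≃ Fin n'} {i j : Fin n} {i' j' : Fin n'}
    (hi : σ i = i') (hj : σ j = j') (h : j ≠ i) (h' : j' ≠ i') (μ : Fin m ≃ Fin m') :
    blockPerm σ i μ (outer i m j h) = outer i' m' j' h' := by
  subst hi hj; exact blockPerm_outer σ i μ j h

theorem blockPerm_inner' {n n' m m' : ℕ} {σ : Fin n ≃ Fin n'} {i : Fin n} {i' : Fin n'}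
    (hi : σ i = i') (μ : Fin m ≃ Fin m') (k : Fin m) :
    blockPerm σ i μ (inner i k) = inner i' (μ k) := by
  subst hi; exact blockPerm_inner σ i μ k

theorem blockPerm_blockPerm_inner {n n' m m' l l' : ℕ} (σ : Fin n ≃ Fin n') (i : Fin n)
    (μ : Fin m ≃ Fin m') (j : Fin m) (ν : Fin l ≃ Fin l') (p : Fin (n + m - 1 + l - 1))
    (q : Fin (n + (m + l - 1) - 1)) (hq : (p : ℕ) = q) :
    (blockPerm (blockPerm σ i μ) (inner i j) ν p : ℕ) =
      blockPerm σ i (blockPerm μ j ν) q := by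
  have hij := blockPerm_inner σ i μ j
  revert p
  refine slot_cases (inner i j) (slot_cases i ?_ ?_) ?_
  · intro a ha h hq
    rw [pos_inner_outer i j a ha h hq,
      blockPerm_outer' hij (blockPerm_outer σ i μ a ha) _ inner_ne_outer.symm, blockPerm_outer]
    exact pos_inner_outer_val _ _ _ _ _
  · intro b h hq
    have hb : b ≠ j := fun e => h (congrArg _ e)
    rw [pos_inner_inner_outer i j b h hq,
      blockPerm_outer' hij (blockPerm_inner σ i μ b) _ (inner_ne_inner (μ.injective.ne hb)),
      blockPerm_inner, blockPerm_outer]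
    exact pos_inner_inner_outer_val _ _ _ _
  · intro k hq
    rw [pos_inner_inner i j k hq, blockPerm_inner' hij, blockPerm_inner, blockPerm_inner]
    exact pos_inner_inner_val _ _ _

theorem blockPerm_blockPerm_outer {n n' m m' l l' : ℕ} (σ : Fin n ≃ Fin n') (i k : Fin n)
    (hk : k ≠ i) (μ : Fin m ≃ Fin m') (ν : Fin l ≃ Fin l') (p : Fin (n + m - 1 + l - 1))
    (q : Fin (n + l - 1 + m - 1)) (hq : (p : ℕ) = q) :
    (blockPerm (blockPerm σ i μ) (outer i m k hk) ν p : ℕ) =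
      blockPerm (blockPerm σ k ν) (outer k l i hk.symm) μ q := by
  have e₁ := blockPerm_outer σ i μ k hk
  have e₂ := blockPerm_outer σ k ν i hk.symm
  have hσ : σ k ≠ σ i := σ.injective.ne hk
  revert p
  refine slot_cases (outer i m k hk) (slot_cases i ?_ ?_) ?_
  · intro a ha h hq
    have h' : a ≠ k := fun e => h (by subst e; rfl)
    rw [pos_outer_outer i k hk a ha h hq,
      blockPerm_outer' e₁ (blockPerm_outer σ i μ a ha) _ (outer_ne_outer (σ.injective.ne h')),
      blockPerm_outer' e₂ (blockPerm_outer σ k ν a h') _ (outer_ne_outer (σ.injective.ne ha))]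
    exact pos_outer_outer_val _ _ hσ _ _ _
  · intro b h hq
    rw [pos_outer_inner i k hk b h hq,
      blockPerm_outer' e₁ (blockPerm_inner σ i μ b) _ inner_ne_outer, blockPerm_inner' e₂]
    exact pos_outer_inner_val _ _ hσ _ _
  · intro b hq
    rw [pos_outer_inner' i k hk b hq, blockPerm_inner' e₁,
      blockPerm_outer' e₂ (blockPerm_inner σ k ν b) _ inner_ne_outer]
    exact pos_outer_inner_val' _ _ hσ _

/-- Tuples of colours `(c₀, …, c_{n-1})`. -/
structure Tuple (C : Type w) where
  len : ℕ
  col : Fin len → C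

namespace Tuple

variable {C : Type w} {D : Type w}

theorem ext_of {c d : Tuple C} (h : c.len = d.len)
    (h' : ∀ (p : Fin c.len) (q : Fin d.len), (p : ℕ) = q → c.col p = d.col q) : c = d := by
  obtain ⟨n, c⟩ := c
  obtain ⟨m, d⟩ := d
  obtain rfl : n = m := h
  exact congrArg _ (funext fun i => h' i i rfl)

/-- The one-term tuple `(x)`. -/
abbrev single (x : C) : Tuple C := ⟨1, fun _ => x⟩

/-- The tuple `c ◁ᵢ c'`, in which the entry `i` of `c` is replaced by the entries of `c'`. -/
abbrev insert (c : Tuple C) (i : Fin c.len) (c' : Tuple C) : Tuple C :=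
  ⟨c.len + c'.len - 1,
    fun p => Sum.elim (fun j => c.col j.1) c'.col ((slot i c'.len).symm p)⟩

/-- The tuple `c^σ = (c_{σ(0)}, …, c_{σ(n-1)})`. -/
abbrev perm (c : Tuple C) (σ : Equiv.Perm (Fin c.len)) : Tuple C := ⟨c.len, fun i => c.col (σ i)⟩

/-- The image of a tuple under a map of colours. -/
abbrev map (f : C → D) (c : Tuple C) : Tuple D := ⟨c.len, fun i => f (c.col i)⟩

theorem insert_col_outer (c : Tuple C) (i : Fin c.len) (c' : Tuple C) (j : Fin c.len)
    (h : j ≠ i) : (c.insert i c').col (outer i c'.len j h) = c.col j := by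
  simp

theorem insert_col_inner (c : Tuple C) (i : Fin c.len) (c' : Tuple C) (k : Fin c'.len) :
    (c.insert i c').col (inner i k) = c'.col k := by
  simp

theorem col_congr (c : Tuple C) {p q : Fin c.len} (h : (p : ℕ) = q) : c.col p = c.col q :=
  congrArg _ (Fin.ext h)

theorem single_insert (x : C) (c : Tuple C) :
    (single x).insert (0 : Fin 1) c = c := by
  refine ext_of (Nat.add_sub_cancel_left 1 c.len) (slot_cases (n := 1) 0 ?_ ?_)
  · intro j h; exact absurd (Subsingleton.elim _ _) h
  · intro k q hq
    refine (insert_col_inner (single x) (0 : Fin 1) c k).trans (col_congr c ?_)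
    refine .trans ?_ hq
    simp [inner_val]

theorem insert_single (c : Tuple C) (i : Fin c.len) {y : C} (hy : c.col i = y) :
    c.insert i (single y) = c := by
  subst hy
  refine ext_of rfl (slot_cases (m := 1) i ?_ ?_)
  · intro j h q hq
    refine (insert_col_outer c i (single (c.col i)) j h).trans (col_congr c ?_)
    have := outer_val i 1 j h
    refine Eq.trans ?_ hq
    refine Eq.trans ?_ this.symm
    split_ifs <;> omega
  · intro k q hq
    refine (insert_col_inner c i (single (c.col i)) k).trans (col_congr c ?_)
    have := inner_val i k
    refine Eq.trans ?_ hq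
    refine Eq.trans ?_ this.symm
    omega

/-- `(c ◁ᵢ c') ◁ c'' = c ◁ᵢ (c' ◁ⱼ c'')`. -/
theorem insert_insert_inner (c : Tuple C) (i : Fin c.len) (c' : Tuple C) (j : Fin c'.len)
    (c'' : Tuple C) :
    (c.insert i c').insert (inner i j) c'' = c.insert i (c'.insert j c'') := by
  refine ext_of (len_insert_inner i j _) ?_
  refine slot_cases (inner i j) (slot_cases i ?_ ?_) ?_
  · intro a ha h q hq
    rw [pos_inner_outer (l := c''.len) i j a ha h hq]
    refine (insert_col_outer (c.insert i c') _ c'' _ h).trans ?_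
    exact (insert_col_outer c i c' _ ha).trans
      (insert_col_outer c i (c'.insert j c'') _ ha).symm
  · intro b h q hq
    rw [pos_inner_inner_outer (l := c''.len) i j b h hq]
    refine (insert_col_outer (c.insert i c') _ c'' _ h).trans ?_
    refine (insert_col_inner c i c' b).trans ?_
    refine .trans ?_ (insert_col_inner c i (c'.insert j c'') _).symm
    exact (insert_col_outer c' j c'' b _).symm
  · intro k q hq
    rw [pos_inner_inner i j k hq]
    refine (insert_col_inner (c.insert i c') _ c'' k).trans ?_
    refine .trans ?_ (insert_col_inner c i (c'.insert j c'') _).symm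
    exact (insert_col_inner c' j c'' k).symm

/-- Substitutions at two different entries commute. -/
theorem insert_insert_outer (c : Tuple C) (i k : Fin c.len) (h : k ≠ i) (c' c'' : Tuple C) :
    (c.insert i c').insert (outer i c'.len k h) c'' =
      (c.insert k c'').insert (outer k c''.len i h.symm) c' := by
  refine ext_of (len_insert_outer i k h _ _) ?_
  refine slot_cases (outer i c'.len k h) (slot_cases i ?_ ?_) ?_
  · intro a ha h' q hq
    rw [pos_outer_outer (l := c''.len) i k h a ha h' hq]
    refine (insert_col_outer (c.insert i c') _ c'' _ h').trans ?_
    refine (insert_col_outer c i c' _ ha).trans ?_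
    refine .trans ?_ (insert_col_outer (c.insert k c'') _ c' _ _).symm
    exact (insert_col_outer c k c'' _ _).symm
  · intro b h' q hq
    rw [pos_outer_inner (l := c''.len) i k h b h' hq]
    refine (insert_col_outer (c.insert i c') _ c'' _ h').trans ?_
    refine (insert_col_inner c i c' b).trans ?_
    exact (insert_col_inner (c.insert k c'') _ c' b).symm
  · intro b q hq
    rw [pos_outer_inner' (m := c'.len) i k h b hq]
    refine (insert_col_inner (c.insert i c') _ c'' b).trans ?_
    refine .trans ?_ (insert_col_outer (c.insert k c'') _ c' _ _).symm
    exact (insert_col_inner c k c'' b).symm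

theorem perm_insert (c : Tuple C) (σ : Equiv.Perm (Fin c.len)) (i : Fin c.len) (c' : Tuple C)
    (μ : Equiv.Perm (Fin c'.len)) :
    (c.perm σ).insert i (c'.perm μ) = (c.insert (σ i) c').perm (blockPerm σ i μ) := by
  refine congrArg (Tuple.mk _) (funext (slot_cases i ?_ ?_))
  · intro j h
    refine (insert_col_outer (c.perm σ) i (c'.perm μ) j h).trans ?_
    refine .trans ?_ (congrArg (c.insert (σ i) c').col (blockPerm_outer σ i μ j h).symm)
    exact (insert_col_outer c (σ i) c' _ _).symm
  · intro k
    refine (insert_col_inner (c.perm σ) i (c'.perm μ) k).trans ?_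
    refine .trans ?_ (congrArg (c.insert (σ i) c').col (blockPerm_inner σ i μ k).symm)
    exact (insert_col_inner c (σ i) c' _).symm

theorem map_insert (f : C → D) (c : Tuple C) (i : Fin c.len) (c' : Tuple C) :
    (c.map f).insert i (c'.map f) = (c.insert i c').map f := by
  refine congrArg (Tuple.mk _) (funext (slot_cases i ?_ ?_))
  · intro j h
    refine (insert_col_outer (c.map f) i (c'.map f) j h).trans ?_
    exact congrArg f (insert_col_outer c i c' _ h).symm
  · intro k
    refine (insert_col_inner (c.map f) i (c'.map f) k).trans ?_
    exact congrArg f (insert_col_inner c i c' _).symm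

end Tuple
end ColouredOperad

namespace ColouredOperad

variable (E : Type u) [Category.{v} E] [MonoidalCategory E] [SymmetricCategory E]

/-- A planar operad enriched in `E`, with an arbitrary set of colours. The partial composition
`γᵢ : P(c; x) ⊗ P(c'; cᵢ) ⟶ P(c ◁ᵢ c'; x)` is written with a name `y` for the colour `cᵢ` and a
name `d` for the tuple `c ◁ᵢ c'`, so that no transport along equalities of tuples is needed. -/
structure PlanarOperad where
  Col : Type w
  obj : Tuple Col → Col → E
  circ : ∀ {c : Tuple Col} {x : Col} {c' : Tuple Col} {y : Col} {d : Tuple Col} (i : Fin c.len),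
    c.col i = y → c.insert i c' = d → (obj c x ⊗ obj c' y ⟶ obj d x)
  one : ∀ x : Col, 𝟙_ E ⟶ obj (Tuple.single x) x
  one_circ : ∀ (c : Tuple Col) (x : Col),
    one x ▷ obj c x ≫ circ (c := Tuple.single x) (0 : Fin 1) rfl (Tuple.single_insert x c) =
      (λ_ (obj c x)).hom
  circ_one : ∀ (c : Tuple Col) (x : Col) (i : Fin c.len) (y : Col) (hy : c.col i = y),
    obj c x ◁ one y ≫ circ i hy (Tuple.insert_single c i hy) = (ρ_ (obj c x)).hom
  circ_circ_inner : ∀ (c : Tuple Col) (x : Col) (c' : Tuple Col) (y : Col) (c'' : Tuple Col)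
    (z : Col) (d : Tuple Col) (i : Fin c.len) (hy : c.col i = y) (j : Fin c'.len)
    (hz : c'.col j = z) (hd : c.insert i (c'.insert j c'') = d),
    (circ (x := x) i hy (rfl : c.insert i c' = _) ▷ obj c'' z) ≫
        circ (inner i j) ((Tuple.insert_col_inner c i c' j).trans hz)
          ((Tuple.insert_insert_inner c i c' j c'').trans hd) =
      (α_ _ _ _).hom ≫ (obj c x ◁ circ j hz rfl) ≫ circ i hy hd
  circ_circ_outer : ∀ (c : Tuple Col) (x : Col) (c' : Tuple Col) (y : Col) (c'' : Tuple Col)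
    (z : Col) (d : Tuple Col) (i k : Fin c.len) (h : k ≠ i) (hy : c.col i = y)
    (hz : c.col k = z) (hd : (c.insert k c'').insert (outer k c''.len i h.symm) c' = d),
    (circ (x := x) i hy (rfl : c.insert i c' = _) ▷ obj c'' z) ≫
        circ (outer i c'.len k h) ((Tuple.insert_col_outer c i c' k h).trans hz)
          ((Tuple.insert_insert_outer c i k h c' c'').trans hd) =
      (α_ _ _ _).hom ≫ (obj c x ◁ (β_ (obj c' y) (obj c'' z)).hom) ≫ (α_ _ _ _).inv ≫
        (circ (x := x) k hz (rfl : c.insert k c'' = _) ▷ obj c' y) ≫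
          circ (outer k c''.len i h.symm) ((Tuple.insert_col_outer c k c'' i h.symm).trans hy) hd

/-- An operad enriched in `E`: the same data together with a right action
`σ^* : P(c; x) ⟶ P(c^σ; x)` of the symmetric groups with respect to which
the compositions are equivariant. -/
structure Operad extends PlanarOperad.{w} E where
  act : ∀ {c : Tuple Col} {x : Col} {d : Tuple Col} (σ : Equiv.Perm (Fin c.len)),
    c.perm σ = d → (obj c x ⟶ obj d x)
  act_one : ∀ (c : Tuple Col) (x : Col),
    act (x := x) (1 : Equiv.Perm (Fin c.len)) (rfl : c.perm 1 = c) = 𝟙 (obj c x)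
  act_act : ∀ (c : Tuple Col) (x : Col) (σ μ : Equiv.Perm (Fin c.len)),
    act (x := x) σ (rfl : c.perm σ = _) ≫ act (c := c.perm σ) μ (rfl : (c.perm σ).perm μ = _) =
      act (σ * μ) (rfl : c.perm (σ * μ) = (c.perm σ).perm μ)
  act_circ : ∀ (c : Tuple Col) (x : Col) (c' : Tuple Col) (y : Col)
    (σ : Equiv.Perm (Fin c.len)) (μ : Equiv.Perm (Fin c'.len)) (i : Fin c.len)
    (hy : c.col (σ i) = y),
    (act (x := x) σ (rfl : c.perm σ = _) ⊗ₘ act (x := y) μ (rfl : c'.perm μ = _)) ≫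
        circ (c := c.perm σ) i hy (Tuple.perm_insert c σ i c' μ) =
      circ (σ i) hy (rfl : c.insert (σ i) c' = _) ≫ act (blockPerm σ i μ) rfl

variable {E}

namespace PlanarOperad

/-- Morphisms of planar operads. -/
structure Hom (P Q : PlanarOperad.{w} E) where
  onCol : P.Col → Q.Col
  app : ∀ (c : Tuple P.Col) (x : P.Col), P.obj c x ⟶ Q.obj (c.map onCol) (onCol x)
  one_app : ∀ x, P.one x ≫ app (Tuple.single x) x = Q.one (onCol x)
  circ_app : ∀ (c : Tuple P.Col) (x : P.Col) (c' : Tuple P.Col) (y : P.Col) (i : Fin c.len)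
    (hy : c.col i = y),
    P.circ i hy (rfl : c.insert i c' = _) ≫ app (c.insert i c') x =
      (app c x ⊗ₘ app c' y) ≫
        Q.circ (c := c.map onCol) i (congrArg onCol hy) (Tuple.map_insert onCol c i c')

theorem Hom.ext {P Q : PlanarOperad.{w} E} {f g : Hom P Q} (h : f.onCol = g.onCol)
    (h' : HEq f.app g.app) : f = g := by
  cases f
  cases g
  cases h
  cases h'
  rfl

theorem Hom.circ_app' {P Q : PlanarOperad.{w} E} (f : Hom P Q) {c : Tuple P.Col} {x : P.Col}
    {c' : Tuple P.Col} {y : P.Col} (i : Fin c.len) (hy : c.col i = y) {d : Tuple P.Col}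
    (hd : c.insert i c' = d) :
    P.circ i hy hd ≫ f.app d x =
      (f.app c x ⊗ₘ f.app c' y) ≫ Q.circ (c := c.map f.onCol) i (congrArg f.onCol hy)
        ((Tuple.map_insert f.onCol c i c').trans (congrArg _ hd)) := by
  subst hd
  exact f.circ_app c x c' y i hy

/-- The identity morphism of a planar operad. -/
abbrev idHom (P : PlanarOperad.{w} E) : Hom P P where
  onCol x := x
  app c x := 𝟙 (P.obj c x)
  one_app x := Category.comp_id _
  circ_app c x c' y i hy := by
    rw [Category.comp_id, id_tensorHom_id, Category.id_comp]

/-- The composite of two morphisms of planar operads. -/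
abbrev compHom {P Q R : PlanarOperad.{w} E} (f : Hom P Q) (g : Hom Q R) : Hom P R where
  onCol x := g.onCol (f.onCol x)
  app c x := f.app c x ≫ g.app (c.map f.onCol) (f.onCol x)
  one_app x := by
    rw [← Category.assoc, f.one_app]
    exact g.one_app _
  circ_app c x c' y i hy := by
    rw [← Category.assoc, f.circ_app, Category.assoc,
      g.circ_app' (c := c.map f.onCol) (c' := c'.map f.onCol)
        i (congrArg f.onCol hy) (Tuple.map_insert f.onCol c i c'),
      ← Category.assoc, tensorHom_comp_tensorHom]

instance : Category (PlanarOperad.{w} E) where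
  Hom := Hom
  id := idHom
  comp := compHom
  id_comp f := by
    refine Hom.ext rfl (heq_of_eq ?_)
    funext c x
    exact Category.id_comp _
  comp_id f := by
    refine Hom.ext rfl (heq_of_eq ?_)
    funext c x
    exact Category.comp_id _
  assoc f g h := by
    refine Hom.ext rfl (heq_of_eq ?_)
    funext c x
    exact Category.assoc _ _ _

end PlanarOperad

namespace Operad

theorem act_circ' (P : Operad.{w} E) {c : Tuple P.Col} {x : P.Col} {c' : Tuple P.Col} {y : P.Col}
    (σ : Equiv.Perm (Fin c.len)) (μ : Equiv.Perm (Fin c'.len)) (i : Fin c.len)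
    (hy : c.col (σ i) = y) {d f : Tuple P.Col} (hd : (c.perm σ).insert i (c'.perm μ) = d)
    (hf : c.insert (σ i) c' = f) (τ : Equiv.Perm (Fin f.len)) (hτ : HEq τ (blockPerm σ i μ))
    (hd' : f.perm τ = d) :
    (P.act (x := x) σ (rfl : c.perm σ = _) ⊗ₘ P.act (x := y) μ (rfl : c'.perm μ = _)) ≫
        P.circ (c := c.perm σ) i hy hd =
      P.circ (σ i) hy hf ≫ P.act τ hd' := by
  subst hf
  obtain rfl := eq_of_heq hτ
  subst hd'
  exact P.act_circ c x c' y σ μ i hy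

/-- Morphisms of operads. -/
structure Hom (P Q : Operad.{w} E) extends PlanarOperad.Hom P.toPlanarOperad Q.toPlanarOperad where
  act_app : ∀ (c : Tuple P.Col) (x : P.Col) (σ : Equiv.Perm (Fin c.len)),
    P.act σ (rfl : c.perm σ = _) ≫ app (c.perm σ) x =
      app c x ≫ Q.act (c := c.map onCol) σ rfl

theorem Hom.ext_app {P Q : Operad.{w} E} {f g : Hom P Q} (h : f.onCol = g.onCol)
    (h' : HEq f.app g.app) : f = g := by
  obtain ⟨f, _⟩ := f
  obtain ⟨g, _⟩ := g
  obtain rfl : f = g := PlanarOperad.Hom.ext h h'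
  rfl

theorem Hom.act_app' {P Q : Operad.{w} E} (f : Hom P Q) {c : Tuple P.Col} {x : P.Col}
    (σ : Equiv.Perm (Fin c.len)) {d : Tuple P.Col} (hd : c.perm σ = d) :
    P.act σ hd ≫ f.app d x =
      f.app c x ≫ Q.act (c := c.map f.onCol) σ (congrArg (Tuple.map f.onCol) hd) := by
  subst hd
  exact f.act_app c x σ

/-- The identity morphism of an operad. -/
abbrev idHom (P : Operad.{w} E) : Hom P P where
  toHom := PlanarOperad.idHom P.toPlanarOperad
  act_app c x σ := by rw [Category.comp_id, Category.id_comp]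

/-- The composite of two morphisms of operads. -/
abbrev compHom {P Q R : Operad.{w} E} (f : Hom P Q) (g : Hom Q R) : Hom P R where
  toHom := PlanarOperad.compHom f.toHom g.toHom
  act_app c x σ := by
    rw [← Category.assoc, f.act_app, Category.assoc, Category.assoc,
      g.act_app (c.map f.onCol) (f.onCol x) σ]

instance : Category (Operad.{w} E) where
  Hom := Hom
  id := idHom
  comp := compHom
  id_comp f := by
    refine Hom.ext_app rfl (heq_of_eq ?_)
    funext c x
    exact Category.id_comp _
  comp_id f := by
    refine Hom.ext_app rfl (heq_of_eq ?_)
    funext c x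
    exact Category.comp_id _
  assoc f g h := by
    refine Hom.ext_app rfl (heq_of_eq ?_)
    funext c x
    exact Category.assoc _ _ _

end Operad
end ColouredOperad

namespace ColouredOperad

variable {E : Type u} [Category.{v} E] [MonoidalCategory E] [SymmetricCategory E]

theorem tensorμ_braiding (X₁ X₂ Y₁ Y₂ : E) :
    tensorμ X₁ X₂ Y₁ Y₂ ≫ ((β_ X₁ Y₁).hom ⊗ₘ (β_ X₂ Y₂).hom) =
      (β_ (X₁ ⊗ X₂) (Y₁ ⊗ Y₂)).hom ≫ tensorμ Y₁ Y₂ X₁ X₂ := by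
  have h : Y₁ ◁ (β_ X₁ Y₂).hom ▷ X₂ ≫ Y₁ ◁ (β_ Y₂ X₁).hom ▷ X₂ = 𝟙 _ := by
    rw [← whiskerLeft_comp, ← comp_whiskerRight, SymmetricCategory.symmetry]; simp
  simp [tensorμ, MonoidalCategory.tensorHom_def, reassoc_of% h]

/-- The exchange `(X ⊗ Y) ⊗ Z ⟶ (X ⊗ Z) ⊗ Y`. -/
abbrev exch (X Y Z : E) : (X ⊗ Y) ⊗ Z ⟶ (X ⊗ Z) ⊗ Y :=
  (α_ X Y Z).hom ≫ X ◁ (β_ Y Z).hom ≫ (α_ X Z Y).inv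

theorem tensor_exch (X₁ X₂ Y₁ Y₂ Z₁ Z₂ : E) :
    tensorμ X₁ X₂ Y₁ Y₂ ▷ (Z₁ ⊗ Z₂) ≫ tensorμ (X₁ ⊗ Y₁) (X₂ ⊗ Y₂) Z₁ Z₂ ≫
      (exch X₁ Y₁ Z₁ ⊗ₘ exch X₂ Y₂ Z₂) =
    exch (X₁ ⊗ X₂) (Y₁ ⊗ Y₂) (Z₁ ⊗ Z₂) ≫ tensorμ X₁ X₂ Z₁ Z₂ ▷ (Y₁ ⊗ Y₂) ≫
      tensorμ (X₁ ⊗ Z₁) (X₂ ⊗ Z₂) Y₁ Y₂ := by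
  rw [← cancel_mono ((α_ X₁ Z₁ Y₁).hom ⊗ₘ (α_ X₂ Z₂ Y₂).hom)]
  simp only [Category.assoc, tensor_associativity, tensorHom_comp_tensorHom]
  simp only [Iso.inv_hom_id, Category.comp_id, Iso.inv_hom_id_assoc]
  rw [← tensorHom_comp_tensorHom, tensor_associativity_assoc,
    ← tensorμ_natural_right, ← whiskerLeft_comp_assoc, tensorμ_braiding,
    whiskerLeft_comp_assoc]

namespace PlanarOperad

theorem circ_circ_inner' (P : PlanarOperad.{w} E) {c : Tuple P.Col} {x : P.Col}
    {c' : Tuple P.Col} {y : P.Col} {c'' : Tuple P.Col} {z : P.Col} {d e f : Tuple P.Col}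
    (i : Fin c.len) (hy : c.col i = y) (j : Fin c'.len) (hz : c'.col j = z)
    (he : c.insert i c' = e) (p : Fin e.len) (hp : (p : ℕ) = inner i j) (hz' : e.col p = z)
    (hd : e.insert p c'' = d) (hf : c'.insert j c'' = f) (hd' : c.insert i f = d) :
    (P.circ (x := x) i hy he ▷ P.obj c'' z) ≫ P.circ p hz' hd =
      (α_ _ _ _).hom ≫ (P.obj c x ◁ P.circ j hz hf) ≫ P.circ i hy hd' := by
  subst he hf
  obtain rfl : p = inner i j := Fin.ext hp
  exact P.circ_circ_inner c x c' y c'' z d i hy j hz hd'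

theorem circ_circ_outer' (P : PlanarOperad.{w} E) {c : Tuple P.Col} {x : P.Col}
    {c' : Tuple P.Col} {y : P.Col} {c'' : Tuple P.Col} {z : P.Col} {d e f : Tuple P.Col}
    (i k : Fin c.len) (h : k ≠ i) (hy : c.col i = y) (hz : c.col k = z)
    (he : c.insert i c' = e) (p : Fin e.len) (hp : (p : ℕ) = outer i c'.len k h)
    (hz' : e.col p = z) (hd : e.insert p c'' = d)
    (hf : c.insert k c'' = f) (q : Fin f.len) (hq : (q : ℕ) = outer k c''.len i h.symm)
    (hy' : f.col q = y) (hd' : f.insert q c' = d) :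
    (P.circ (x := x) i hy he ▷ P.obj c'' z) ≫ P.circ p hz' hd =
      exch _ _ _ ≫ (P.circ (x := x) k hz hf ▷ P.obj c' y) ≫ P.circ q hy' hd' := by
  subst he hf
  obtain rfl : p = outer i c'.len k h := Fin.ext hp
  obtain rfl : q = outer k c''.len i h.symm := Fin.ext hq
  simp only [exch, Category.assoc]
  exact P.circ_circ_outer c x c' y c'' z d i k h hy hz hd'

end PlanarOperad

namespace Operad

/-- The Hadamard tensor product of two operads. -/
def hadamard (P Q : Operad.{w} E) : Operad.{w} E where
  Col := P.Col × Q.Col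
  obj c x := P.obj (c.map Prod.fst) x.1 ⊗ Q.obj (c.map Prod.snd) x.2
  circ {c x c' y d} i hy hd := tensorμ _ _ _ _ ≫
    (P.circ (c := c.map Prod.fst) (c' := c'.map Prod.fst) i (congrArg Prod.fst hy)
        ((Tuple.map_insert Prod.fst c i c').trans (congrArg _ hd)) ⊗ₘ
      Q.circ (c := c.map Prod.snd) (c' := c'.map Prod.snd) i (congrArg Prod.snd hy)
        ((Tuple.map_insert Prod.snd c i c').trans (congrArg _ hd)))
  one x := (λ_ (𝟙_ E)).inv ≫ (P.one x.1 ⊗ₘ Q.one x.2)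
  act {c x d} σ hd :=
    P.act (c := c.map Prod.fst) σ (congrArg (Tuple.map Prod.fst) hd) ⊗ₘ
      Q.act (c := c.map Prod.snd) σ (congrArg (Tuple.map Prod.snd) hd)
  one_circ c x := by
    rw [comp_whiskerRight, Category.assoc, tensorμ_natural_left_assoc, tensorHom_comp_tensorHom,
      P.one_circ, Q.one_circ]
    exact (tensor_left_unitality _ _).symm
  circ_one c x i y hy := by
    rw [whiskerLeft_comp, Category.assoc, tensorμ_natural_right_assoc, tensorHom_comp_tensorHom,
      P.circ_one, Q.circ_one]
    exact (tensor_right_unitality _ _).symm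
  circ_circ_inner c x c' y c'' z d i hy j hz hd := by
    rw [comp_whiskerRight, Category.assoc, tensorμ_natural_left_assoc, tensorHom_comp_tensorHom,
      whiskerLeft_comp, Category.assoc, tensorμ_natural_right_assoc, tensorHom_comp_tensorHom,
      ← tensor_associativity_assoc, tensorHom_comp_tensorHom]
    congr 2
    congr 1
    · exact P.circ_circ_inner' (c := c.map Prod.fst) (c' := c'.map Prod.fst)
        (c'' := c''.map Prod.fst) i _ j _ _ _ rfl _ _ _ _
    · exact Q.circ_circ_inner' (c := c.map Prod.snd) (c' := c'.map Prod.snd)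
        (c'' := c''.map Prod.snd) i _ j _ _ _ rfl _ _ _ _
  circ_circ_outer c x c' y c'' z d i k h hy hz hd := by
    have key := tensor_exch (P.obj (c.map Prod.fst) x.1) (Q.obj (c.map Prod.snd) x.2)
      (P.obj (c'.map Prod.fst) y.1) (Q.obj (c'.map Prod.snd) y.2)
      (P.obj (c''.map Prod.fst) z.1) (Q.obj (c''.map Prod.snd) z.2)
    rw [comp_whiskerRight, Category.assoc, tensorμ_natural_left_assoc, tensorHom_comp_tensorHom,
      comp_whiskerRight, Category.assoc, tensorμ_natural_left_assoc, tensorHom_comp_tensorHom]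
    rw [P.circ_circ_outer' (c := c.map Prod.fst) (c' := c'.map Prod.fst)
        (c'' := c''.map Prod.fst) i k h _ (congrArg Prod.fst hz) _ _ rfl _ _
        (Tuple.map_insert Prod.fst c k c'') (outer k c''.len i h.symm) rfl
        (congrArg Prod.fst ((Tuple.insert_col_outer c k c'' i h.symm).trans hy))
        ((Tuple.map_insert Prod.fst (c.insert k c'') _ c').trans (congrArg _ hd)),
      Q.circ_circ_outer' (c := c.map Prod.snd) (c' := c'.map Prod.snd)
        (c'' := c''.map Prod.snd) i k h _ (congrArg Prod.snd hz) _ _ rfl _ _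
        (Tuple.map_insert Prod.snd c k c'') (outer k c''.len i h.symm) rfl
        (congrArg Prod.snd ((Tuple.insert_col_outer c k c'' i h.symm).trans hy))
        ((Tuple.map_insert Prod.snd (c.insert k c'') _ c').trans (congrArg _ hd)),
      ← tensorHom_comp_tensorHom, reassoc_of% key]
  act_one c x := by
    rw [P.act_one, Q.act_one]
    exact id_tensorHom_id _ _
  act_act c x σ μ := by
    rw [tensorHom_comp_tensorHom, P.act_act, Q.act_act]
    rfl
  act_circ c x c' y σ μ i hy := by
    rw [tensorμ_natural_assoc, tensorHom_comp_tensorHom,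
      Category.assoc, tensorHom_comp_tensorHom]
    congr 2
    · exact P.act_circ' (c := c.map Prod.fst) (c' := c'.map Prod.fst) σ μ i _ _ _ _ HEq.rfl _
    · exact Q.act_circ' (c := c.map Prod.snd) (c' := c'.map Prod.snd) σ μ i _ _ _ _ HEq.rfl _

/-- The operad `uCom`, with one colour and `uCom(n) = 𝟙`. -/
abbrev uCom : Operad.{w} E where
  Col := PUnit
  obj _ _ := 𝟙_ E
  circ _ _ _ := (λ_ (𝟙_ E)).hom
  one _ := 𝟙 _
  act _ _ := 𝟙 _
  one_circ c x := by simp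
  circ_one c x i y hy := by simp [unitors_equal]
  circ_circ_inner := by intros; simp [unitors_equal]
  circ_circ_outer := by intros; simp; monoidal_coherence
  act_one _ _ := rfl
  act_act _ _ _ _ := Category.comp_id _
  act_circ := by intros; simp

/-- The Hadamard tensor product of morphisms. -/
def hadamardMap {P P' Q Q' : Operad.{w} E} (f : P ⟶ P') (g : Q ⟶ Q') :
    hadamard P Q ⟶ hadamard P' Q' where
  onCol x := (f.onCol x.1, g.onCol x.2)
  app c x := f.app (c.map Prod.fst) x.1 ⊗ₘ g.app (c.map Prod.snd) x.2
  one_app x := by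
    simp only [hadamard]
    rw [Category.assoc, tensorHom_comp_tensorHom, f.one_app, g.one_app]
  circ_app c x c' y i hy := by
    simp only [hadamard]
    rw [Category.assoc, tensorHom_comp_tensorHom, tensorμ_natural_assoc,
      tensorHom_comp_tensorHom]
    congr 2
    · exact f.circ_app' (c := c.map Prod.fst) (c' := c'.map Prod.fst) i _ _
    · exact g.circ_app' (c := c.map Prod.snd) (c' := c'.map Prod.snd) i _ _
  act_app c x σ := by
    simp only [hadamard]
    rw [tensorHom_comp_tensorHom, tensorHom_comp_tensorHom]
    congr 1
    · exact f.act_app (c.map Prod.fst) x.1 σ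
    · exact g.act_app (c.map Prod.snd) x.2 σ

theorem circ_inv {A A' B B' T T' : E} (a : A ≅ A') (b : B ≅ B') (t : T ≅ T') {m : A ⊗ B ⟶ T}
    {m' : A' ⊗ B' ⟶ T'} (h : m ≫ t.hom = (a.hom ⊗ₘ b.hom) ≫ m') :
    m' ≫ t.inv = (a.inv ⊗ₘ b.inv) ≫ m := by
  rw [Iso.comp_inv_eq, Category.assoc, h, tensorHom_comp_tensorHom_assoc]
  simp

theorem associator_one {X Y Z : E} (p : 𝟙_ E ⟶ X) (q : 𝟙_ E ⟶ Y) (r : 𝟙_ E ⟶ Z) :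
    ((λ_ (𝟙_ E)).inv ≫ (((λ_ (𝟙_ E)).inv ≫ (p ⊗ₘ q)) ⊗ₘ r)) ≫ (α_ X Y Z).hom =
      (λ_ (𝟙_ E)).inv ≫ (p ⊗ₘ ((λ_ (𝟙_ E)).inv ≫ (q ⊗ₘ r))) := by
  rw [← whiskerRight_comp_tensorHom, ← whiskerLeft_comp_tensorHom, Category.assoc, Category.assoc,
    associator_naturality, ← Category.assoc, ← Category.assoc, ← Category.assoc]
  congr 1
  simp [unitors_inv_equal]

theorem associator_circ {X₁ X₂ X₃ Y₁ Y₂ Y₃ Z₁ Z₂ Z₃ : E} (p : X₁ ⊗ Y₁ ⟶ Z₁) (q : X₂ ⊗ Y₂ ⟶ Z₂)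
    (r : X₃ ⊗ Y₃ ⟶ Z₃) :
    (tensorμ (X₁ ⊗ X₂) X₃ (Y₁ ⊗ Y₂) Y₃ ≫ ((tensorμ X₁ X₂ Y₁ Y₂ ≫ (p ⊗ₘ q)) ⊗ₘ r)) ≫
        (α_ Z₁ Z₂ Z₃).hom =
      ((α_ X₁ X₂ X₃).hom ⊗ₘ (α_ Y₁ Y₂ Y₃).hom) ≫ tensorμ X₁ (X₂ ⊗ X₃) Y₁ (Y₂ ⊗ Y₃) ≫
        (p ⊗ₘ (tensorμ X₂ X₃ Y₂ Y₃ ≫ (q ⊗ₘ r))) := by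
  rw [← whiskerRight_comp_tensorHom, ← whiskerLeft_comp_tensorHom, Category.assoc, Category.assoc,
    associator_naturality, associator_monoidal_assoc]

/-- The associator of the Hadamard tensor product. -/
def associatorHom (P Q R : Operad.{w} E) :
    hadamard (hadamard P Q) R ⟶ hadamard P (hadamard Q R) where
  onCol x := (x.1.1, x.1.2, x.2)
  app c x := (α_ _ _ _).hom
  one_app x := associator_one _ _ _
  circ_app c x c' y i hy := associator_circ _ _ _
  act_app c x σ := associator_naturality _ _ _

/-- The associator of the Hadamard tensor product, as an isomorphism. -/
def associator (P Q R : Operad.{w} E) :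
    hadamard (hadamard P Q) R ≅ hadamard P (hadamard Q R) where
  hom := associatorHom P Q R
  inv :=
    { onCol := fun x => ((x.1, x.2.1), x.2.2)
      app := fun c x => (α_ _ _ _).inv
      one_app := fun x => (Iso.comp_inv_eq _).2 (associator_one _ _ _).symm
      circ_app := fun c x c' y i hy =>
        circ_inv (α_ _ _ _) (α_ _ _ _) (α_ _ _ _) (associator_circ _ _ _)
      act_app := fun c x σ => associator_inv_naturality _ _ _ }
  hom_inv_id := by
    refine Hom.ext_app rfl (heq_of_eq ?_)
    funext c x
    exact Iso.hom_inv_id _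
  inv_hom_id := by
    refine Hom.ext_app rfl (heq_of_eq ?_)
    funext c x
    exact Iso.inv_hom_id _

theorem leftUnitor_circ {X Y Z : E} (p : X ⊗ Y ⟶ Z) :
    (tensorμ (𝟙_ E) X (𝟙_ E) Y ≫ ((λ_ (𝟙_ E)).hom ⊗ₘ p)) ≫ (λ_ Z).hom =
      ((λ_ X).hom ⊗ₘ (λ_ Y).hom) ≫ p := by
  rw [leftUnitor_monoidal, MonoidalCategory.tensorHom_def]
  simp

theorem rightUnitor_circ {X Y Z : E} (p : X ⊗ Y ⟶ Z) :
    (tensorμ X (𝟙_ E) Y (𝟙_ E) ≫ (p ⊗ₘ (λ_ (𝟙_ E)).hom)) ≫ (ρ_ Z).hom =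
      ((ρ_ X).hom ⊗ₘ (ρ_ Y).hom) ≫ p := by
  rw [rightUnitor_monoidal, MonoidalCategory.tensorHom_def']
  simp

/-- The left unitor of the Hadamard tensor product. -/
def leftUnitorHom (P : Operad.{w} E) : hadamard uCom P ⟶ P where
  onCol x := x.2
  app c x := (λ_ _).hom
  one_app x := by simp [hadamard, uCom]
  circ_app c x c' y i hy := leftUnitor_circ _
  act_app c x σ := by
    simp only [hadamard, uCom]
    rw [id_tensorHom, leftUnitor_naturality]

/-- The left unitor of the Hadamard tensor product, as an isomorphism. -/
def leftUnitor (P : Operad.{w} E) : hadamard uCom P ≅ P where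
  hom := leftUnitorHom P
  inv :=
    { onCol := fun x => (PUnit.unit, x)
      app := fun c x => (λ_ _).inv
      one_app := fun x => (Iso.comp_inv_eq _).2
        ((leftUnitorHom P).one_app (PUnit.unit, x)).symm
      circ_app := fun c x c' y i hy => circ_inv (λ_ _) (λ_ _) (λ_ _) (leftUnitor_circ _)
      act_app := fun c x σ => by
        simp only [hadamard, uCom]
        rw [id_tensorHom, leftUnitor_inv_naturality] }
  hom_inv_id := by
    refine Hom.ext_app rfl (heq_of_eq ?_)
    funext c x
    exact Iso.hom_inv_id _
  inv_hom_id := by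
    refine Hom.ext_app rfl (heq_of_eq ?_)
    funext c x
    exact Iso.inv_hom_id _

/-- The right unitor of the Hadamard tensor product. -/
def rightUnitorHom (P : Operad.{w} E) : hadamard P uCom ⟶ P where
  onCol x := x.1
  app c x := (ρ_ _).hom
  one_app x := by simp [hadamard, uCom, unitors_inv_equal]
  circ_app c x c' y i hy := rightUnitor_circ _
  act_app c x σ := by
    simp only [hadamard, uCom]
    rw [tensorHom_id, rightUnitor_naturality]

/-- The right unitor of the Hadamard tensor product, as an isomorphism. -/
def rightUnitor (P : Operad.{w} E) : hadamard P uCom ≅ P where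
  hom := rightUnitorHom P
  inv :=
    { onCol := fun x => (x, PUnit.unit)
      app := fun c x => (ρ_ _).inv
      one_app := fun x => (Iso.comp_inv_eq _).2
        ((rightUnitorHom P).one_app (x, PUnit.unit)).symm
      circ_app := fun c x c' y i hy => circ_inv (ρ_ _) (ρ_ _) (ρ_ _) (rightUnitor_circ _)
      act_app := fun c x σ => by
        simp only [hadamard, uCom]
        rw [tensorHom_id, rightUnitor_inv_naturality] }
  hom_inv_id := by
    refine Hom.ext_app rfl (heq_of_eq ?_)
    funext c x
    exact Iso.hom_inv_id _
  inv_hom_id := by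
    refine Hom.ext_app rfl (heq_of_eq ?_)
    funext c x
    exact Iso.inv_hom_id _

/-- The Hadamard monoidal structure on operads. -/
instance : MonoidalCategoryStruct (Operad.{w} E) where
  tensorObj := hadamard
  whiskerLeft P _ _ f := hadamardMap (𝟙 P) f
  whiskerRight f Q := hadamardMap f (𝟙 Q)
  tensorHom := hadamardMap
  tensorUnit := uCom
  associator := associator
  leftUnitor := leftUnitor
  rightUnitor := rightUnitor

instance : MonoidalCategory (Operad.{w} E) := MonoidalCategory.ofTensorHom
  (id_tensorHom_id := fun P Q => by
    refine Hom.ext_app rfl (heq_of_eq ?_)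
    funext c x
    exact MonoidalCategory.id_tensorHom_id _ _)
  (tensorHom_comp_tensorHom := fun f₁ f₂ g₁ g₂ => by
    refine Hom.ext_app rfl (heq_of_eq ?_)
    funext c x
    exact MonoidalCategory.tensorHom_comp_tensorHom _ _ _ _)
  (associator_naturality := fun f₁ f₂ f₃ => by
    refine Hom.ext_app rfl (heq_of_eq ?_)
    funext c x
    exact MonoidalCategory.associator_naturality _ _ _)
  (leftUnitor_naturality := fun f => by
    refine Hom.ext_app rfl (heq_of_eq ?_)
    funext c x
    refine .trans ?_ (MonoidalCategory.leftUnitor_naturality _)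
    exact congrArg (· ≫ _) (MonoidalCategory.id_tensorHom _ _))
  (rightUnitor_naturality := fun f => by
    refine Hom.ext_app rfl (heq_of_eq ?_)
    funext c x
    refine .trans ?_ (MonoidalCategory.rightUnitor_naturality _)
    exact congrArg (· ≫ _) (MonoidalCategory.tensorHom_id _ _))
  (pentagon := fun W X Y Z => by
    refine Hom.ext_app rfl (heq_of_eq ?_)
    funext c x
    refine .trans ?_ (MonoidalCategory.pentagon _ _ _ _)
    rw [← MonoidalCategory.id_tensorHom, ← MonoidalCategory.tensorHom_id]
    rfl)
  (triangle := fun X Y => by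
    refine Hom.ext_app rfl (heq_of_eq ?_)
    funext c x
    refine .trans ?_ (MonoidalCategory.triangle _ _ |>.trans ?_)
    · rw [← MonoidalCategory.id_tensorHom]
      rfl
    · rw [← MonoidalCategory.tensorHom_id]
      rfl)

end Operad
end ColouredOperad

namespace ColouredOperad

variable {E : Type u} [Category.{v} E] [MonoidalCategory E] [SymmetricCategory E]
  [HasFiniteCoproducts E] [∀ X : E, PreservesFiniteCoproducts (tensorLeft X)]

section Coproducts

variable {I J : Type} [Finite I] [Finite J]

/-- `X ⊗ ∐ G` is the coproduct of the `X ⊗ G j`. -/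
noncomputable def leftColim (X : E) (G : J → E) :
    IsColimit (Cofan.mk (X ⊗ ∐ G) fun j => X ◁ Sigma.ι G j) :=
  isColimitCofanMkObjOfIsColimit (tensorLeft X) G _ (coproductIsCoproduct G)

/-- `(∐ F) ⊗ Y` is the coproduct of the `F i ⊗ Y`. -/
noncomputable def rightColim (F : I → E) (Y : E) :
    IsColimit (Cofan.mk ((∐ F) ⊗ Y) fun i => Sigma.ι F i ▷ Y) :=
  haveI : PreservesColimit (Discrete.functor F) (tensorRight Y) :=
    preservesColimit_of_natIso _ (BraidedCategory.tensorLeftIsoTensorRight Y)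
  isColimitCofanMkObjOfIsColimit (tensorRight Y) F _ (coproductIsCoproduct F)

theorem left_hom_ext {X : E} {G : J → E} {Z : E} {f g : X ⊗ ∐ G ⟶ Z}
    (h : ∀ j, X ◁ Sigma.ι G j ≫ f = X ◁ Sigma.ι G j ≫ g) : f = g :=
  Cofan.IsColimit.hom_ext (leftColim X G) _ _ h

theorem right_hom_ext {F : I → E} {Y : E} {Z : E} {f g : (∐ F) ⊗ Y ⟶ Z}
    (h : ∀ i, Sigma.ι F i ▷ Y ≫ f = Sigma.ι F i ▷ Y ≫ g) : f = g :=
  Cofan.IsColimit.hom_ext (rightColim F Y) _ _ h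

theorem tensor_hom_ext {F : I → E} {G : J → E} {Z : E} {f g : (∐ F) ⊗ (∐ G) ⟶ Z}
    (h : ∀ i j, (Sigma.ι F i ⊗ₘ Sigma.ι G j) ≫ f = (Sigma.ι F i ⊗ₘ Sigma.ι G j) ≫ g) : f = g :=
  right_hom_ext fun i => left_hom_ext fun j => by
    simpa [MonoidalCategory.tensorHom_def', whisker_exchange_assoc] using h i j

theorem left_right_hom_ext {X Y : E} {G : J → E} {Z : E} {f g : (X ⊗ ∐ G) ⊗ Y ⟶ Z}
    (h : ∀ j, (X ◁ Sigma.ι G j) ▷ Y ≫ f = (X ◁ Sigma.ι G j) ▷ Y ≫ g) : f = g := by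
  rw [← cancel_epi (exch X Y (∐ G))]
  refine left_hom_ext fun j => ?_
  have e : (X ⊗ Y) ◁ Sigma.ι G j ≫ exch X Y (∐ G) =
      exch X Y (G j) ≫ (X ◁ Sigma.ι G j) ▷ Y := by
    rw [exch, exch, associator_naturality_right_assoc, ← whiskerLeft_comp_assoc,
      BraidedCategory.braiding_naturality_right, whiskerLeft_comp_assoc, associator_inv_naturality_middle,
      Category.assoc, Category.assoc]
  rw [← Category.assoc, e, Category.assoc, h, ← Category.assoc, ← e, Category.assoc]

theorem right_right_hom_ext {F : I → E} {X Y : E} {Z : E} {f g : ((∐ F) ⊗ X) ⊗ Y ⟶ Z}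
    (h : ∀ i, (Sigma.ι F i ▷ X) ▷ Y ≫ f = (Sigma.ι F i ▷ X) ▷ Y ≫ g) : f = g := by
  rw [← cancel_epi (α_ (∐ F) X Y).inv]
  refine right_hom_ext fun i => ?_
  rw [associator_inv_naturality_left_assoc, h, associator_inv_naturality_left_assoc]

theorem tensor_hom_ext₃ {K : Type} [Finite K] {F : I → E} {G : J → E} {H : K → E} {Z : E}
    {f g : ((∐ F) ⊗ (∐ G)) ⊗ (∐ H) ⟶ Z}
    (h : ∀ i j k, ((Sigma.ι F i ⊗ₘ Sigma.ι G j) ⊗ₘ Sigma.ι H k) ≫ f =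
      ((Sigma.ι F i ⊗ₘ Sigma.ι G j) ⊗ₘ Sigma.ι H k) ≫ g) : f = g :=
  left_hom_ext fun k => right_right_hom_ext fun i => left_right_hom_ext fun j => by
    have e : (Sigma.ι F i ⊗ₘ Sigma.ι G j) ⊗ₘ Sigma.ι H k =
        (F i ◁ Sigma.ι G j) ▷ H k ≫ (Sigma.ι F i ▷ (∐ G)) ▷ H k ≫ ((∐ F) ⊗ (∐ G)) ◁ Sigma.ι H k := by
      rw [MonoidalCategory.tensorHom_def (_ ⊗ₘ _), MonoidalCategory.tensorHom_def',
        comp_whiskerRight, Category.assoc]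
    have := h i j k
    rwa [e, Category.assoc, Category.assoc, Category.assoc, Category.assoc] at this

/-- The morphism out of `(∐ F) ⊗ (∐ G)` with given components `F i ⊗ G j ⟶ Z`. -/
noncomputable def tensorDesc {F : I → E} {G : J → E} {Z : E} (f : ∀ i j, F i ⊗ G j ⟶ Z) :
    (∐ F) ⊗ (∐ G) ⟶ Z :=
  Cofan.IsColimit.desc (rightColim F (∐ G)) fun i => Cofan.IsColimit.desc (leftColim (F i) G) (f i)

theorem ι_tensorDesc {F : I → E} {G : J → E} {Z : E} (f : ∀ i j, F i ⊗ G j ⟶ Z) (i : I) (j : J) :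
    (Sigma.ι F i ⊗ₘ Sigma.ι G j) ≫ tensorDesc f = f i j := by
  rw [MonoidalCategory.tensorHom_def', Category.assoc]
  have h₁ : Sigma.ι F i ▷ (∐ G) ≫ tensorDesc f = Cofan.IsColimit.desc (leftColim (F i) G) (f i) :=
    Cofan.IsColimit.fac (rightColim F (∐ G)) _ i
  rw [h₁]
  exact Cofan.IsColimit.fac (leftColim (F i) G) _ j

end Coproducts

theorem Tuple.len_eq_of_equiv {C : Type w} {c e : Tuple C} (σ : Fin c.len ≃ Fin e.len) :
    c.len = e.len := by
  simpa using Fintype.card_congr σ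

namespace PlanarOperad

variable (P : PlanarOperad.{w} E)

/-- The object `∐_{σ ∈ Sₙ} P(c^{σ⁻¹}; x)`. -/
noncomputable abbrev symmObj (c : Tuple P.Col) (x : P.Col) : E :=
  ∐ fun σ : Equiv.Perm (Fin c.len) => P.obj (c.perm σ⁻¹) x

theorem incl_aux {C : Type w} {c e : Tuple C} (σ : Fin c.len ≃ Fin e.len)
    (h : ∀ p, e.col (σ p) = c.col p) :
    e = c.perm (σ.trans (finCongr (Tuple.len_eq_of_equiv σ).symm))⁻¹ := by
  obtain ⟨m, e⟩ := e
  obtain ⟨n, c⟩ := c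
  obtain rfl : n = m := Tuple.len_eq_of_equiv σ
  refine congrArg (Tuple.mk n) (funext fun p => ?_)
  refine .trans ?_ (h _)
  exact congrArg e (σ.apply_symm_apply p).symm

/-- The inclusion in `P_S(c; x)` of the summand `P(e; x)` corresponding to a bijection `σ`
with `c = e ∘ σ`; for `e = c^{σ⁻¹}` it is the coprojection indexed by `σ`. -/
noncomputable def incl {c e : Tuple P.Col} {x : P.Col} (σ : Fin c.len ≃ Fin e.len)
    (h : ∀ p, e.col (σ p) = c.col p) : P.obj e x ⟶ P.symmObj c x :=
  eqToHom (congrArg (fun e => P.obj e x) (incl_aux σ h)) ≫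
    Sigma.ι (fun τ : Equiv.Perm (Fin c.len) => P.obj (c.perm τ⁻¹) x)
      (σ.trans (finCongr (Tuple.len_eq_of_equiv σ).symm))

theorem perm_inv_col {C : Type w} (c : Tuple C) (σ : Equiv.Perm (Fin c.len)) (p : Fin c.len) :
    (c.perm σ⁻¹).col (σ p) = c.col p :=
  congrArg c.col (σ.symm_apply_apply p)

theorem ι_eq_incl {c : Tuple P.Col} {x : P.Col} (σ : Equiv.Perm (Fin c.len)) :
    Sigma.ι (fun τ : Equiv.Perm (Fin c.len) => P.obj (c.perm τ⁻¹) x) σ =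
      P.incl (e := c.perm σ⁻¹) σ (perm_inv_col c σ) :=
  (Category.id_comp _).symm

theorem incl_eq_ι {c e : Tuple P.Col} (σ : Fin c.len ≃ Fin e.len)
    (h : ∀ p, e.col (σ p) = c.col p) : ∃ τ : Equiv.Perm (Fin c.len), c.perm τ⁻¹ = e ∧ HEq σ τ := by
  refine ⟨_, (incl_aux σ h).symm, ?_⟩
  obtain ⟨m, e⟩ := e
  obtain ⟨n, c⟩ := c
  obtain rfl : n = m := Tuple.len_eq_of_equiv σ
  rfl

theorem symm_hom_ext {c : Tuple P.Col} {x : P.Col} {Z : E} {f g : P.symmObj c x ⟶ Z}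
    (h : ∀ (e : Tuple P.Col) (σ : Fin c.len ≃ Fin e.len) (hσ : ∀ p, e.col (σ p) = c.col p),
      P.incl σ hσ ≫ f = P.incl σ hσ ≫ g) : f = g :=
  Sigma.hom_ext _ _ fun σ => by rw [ι_eq_incl]; exact h _ _ _

theorem incl_congr {c e : Tuple P.Col} {x : P.Col} {σ σ' : Fin c.len ≃ Fin e.len}
    (hσ : ∀ p, (σ p : ℕ) = σ' p) (h : ∀ p, e.col (σ p) = c.col p)
    (h' : ∀ p, e.col (σ' p) = c.col p) : P.incl (x := x) σ h = P.incl σ' h' := by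
  obtain rfl : σ = σ' := Equiv.ext fun p => Fin.ext (hσ p)
  rfl

theorem circ_incl_congr {c c' : Tuple P.Col} {x y : P.Col} {i : Fin c.len} (hy : c.col i = y)
    {e f f' : Tuple P.Col} (hf : c.insert i c' = f) (hf' : c.insert i c' = f')
    {σ : Fin e.len ≃ Fin f.len} {σ' : Fin e.len ≃ Fin f'.len}
    (hσ : ∀ p, (σ p : ℕ) = σ' p) (h : ∀ p, f.col (σ p) = e.col p)
    (h' : ∀ p, f'.col (σ' p) = e.col p) :
    P.circ (x := x) i hy hf ≫ P.incl σ h = P.circ i hy hf' ≫ P.incl σ' h' := by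
  obtain rfl : f = f' := hf.symm.trans hf'
  rw [P.incl_congr hσ]

theorem blockPerm_col {C : Type w} {c e c' e' : Tuple C} (σ : Fin c.len ≃ Fin e.len)
    (h : ∀ p, e.col (σ p) = c.col p) (i : Fin c.len) (μ : Fin c'.len ≃ Fin e'.len)
    (h' : ∀ p, e'.col (μ p) = c'.col p) (p : Fin (c.len + c'.len - 1)) :
    (e.insert (σ i) e').col (blockPerm σ i μ p) = (c.insert i c').col p := by
  revert p
  refine slot_cases i ?_ ?_
  · intro j hj
    rw [blockPerm_outer]
    exact (Tuple.insert_col_outer _ _ _ _ _).trans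
      ((h j).trans (Tuple.insert_col_outer c i c' j hj).symm)
  · intro k
    rw [blockPerm_inner]
    exact (Tuple.insert_col_inner _ _ _ _).trans
      ((h' k).trans (Tuple.insert_col_inner c i c' k).symm)

/-- The composition of `P_S`: on the summands indexed by `σ` and `μ` it is the composition
`γ_{σ(i)}` of `P`, with values in the summand indexed by `σ ◁ᵢ μ`. -/
noncomputable def symmCirc {c : Tuple P.Col} {x : P.Col} {c' : Tuple P.Col} {y : P.Col}
    {d : Tuple P.Col} (i : Fin c.len) (hy : c.col i = y) (hd : c.insert i c' = d) :
    P.symmObj c x ⊗ P.symmObj c' y ⟶ P.symmObj d x :=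
  tensorDesc fun σ μ =>
    P.circ (c := c.perm σ⁻¹) (c' := c'.perm μ⁻¹) (σ i) ((perm_inv_col c σ i).trans hy) rfl ≫
      P.incl ((finCongr (congrArg Tuple.len hd.symm)).trans (blockPerm σ i μ)) (by
        subst hd
        exact blockPerm_col (e := c.perm σ⁻¹) (e' := c'.perm μ⁻¹) σ (perm_inv_col c σ) i μ
          (perm_inv_col c' μ))

theorem incl_symmCirc {c : Tuple P.Col} {x : P.Col} {c' : Tuple P.Col} {y : P.Col}
    {d : Tuple P.Col} (i : Fin c.len) (hy : c.col i = y) (hd : c.insert i c' = d)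
    {e e' f : Tuple P.Col} (σ : Fin c.len ≃ Fin e.len) (hσ : ∀ p, e.col (σ p) = c.col p)
    (μ : Fin c'.len ≃ Fin e'.len) (hμ : ∀ p, e'.col (μ p) = c'.col p)
    (hy' : e.col (σ i) = y) (hf : e.insert (σ i) e' = f) (τ : Fin d.len ≃ Fin f.len)
    (hτ : ∀ (p : Fin d.len) (q : Fin (c.len + c'.len - 1)), (p : ℕ) = q →
      (τ p : ℕ) = blockPerm σ i μ q) (hτ' : ∀ p, f.col (τ p) = d.col p) :
    (P.incl (x := x) σ hσ ⊗ₘ P.incl (x := y) μ hμ) ≫ P.symmCirc i hy hd =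
      P.circ (σ i) hy' hf ≫ P.incl τ hτ' := by
  obtain ⟨σ', rfl, h⟩ := P.incl_eq_ι σ hσ
  obtain rfl := (eq_of_heq h).symm
  obtain ⟨μ', rfl, h⟩ := P.incl_eq_ι μ hμ
  obtain rfl := (eq_of_heq h).symm
  rw [← ι_eq_incl, ← ι_eq_incl, symmCirc, ι_tensorDesc]
  refine P.circ_incl_congr _ _ _ (fun p => (hτ p (Fin.cast (congrArg Tuple.len hd.symm) p) rfl).symm) _ _

/-- The action of the symmetric groups on `P_S`, which sends the summand indexed by `σ` to the
summand indexed by `σ ∘ μ`. -/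
noncomputable def symmAct {c : Tuple P.Col} {x : P.Col} {d : Tuple P.Col}
    (μ : Equiv.Perm (Fin c.len)) (hd : c.perm μ = d) : P.symmObj c x ⟶ P.symmObj d x :=
  Sigma.desc fun σ =>
    P.incl (e := c.perm σ⁻¹) ((finCongr (congrArg Tuple.len hd.symm)).trans (μ.trans σ)) (by
      subst hd
      exact fun p => perm_inv_col c σ (μ p))

theorem incl_symmAct {c : Tuple P.Col} {x : P.Col} {d e : Tuple P.Col}
    (μ : Equiv.Perm (Fin c.len)) (hd : c.perm μ = d) (σ : Fin c.len ≃ Fin e.len)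
    (hσ : ∀ p, e.col (σ p) = c.col p) (τ : Fin d.len ≃ Fin e.len)
    (hτ : ∀ (p : Fin d.len) (q : Fin c.len), (p : ℕ) = q → (τ p : ℕ) = σ (μ q)) (hτ' : ∀ p, e.col (τ p) = d.col p) :
    P.incl (x := x) σ hσ ≫ P.symmAct μ hd = P.incl τ hτ' := by
  obtain ⟨σ', rfl, h⟩ := P.incl_eq_ι σ hσ
  obtain rfl := (eq_of_heq h).symm
  rw [← ι_eq_incl, symmAct, Sigma.ι_desc]
  exact P.incl_congr (fun p => (hτ p (Fin.cast (show d.len = c.len by subst hd; rfl) p) rfl).symm) _ _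

end PlanarOperad

end ColouredOperad

namespace ColouredOperad

variable {E : Type u} [Category.{v} E] [MonoidalCategory E] [SymmetricCategory E]
  [HasFiniteCoproducts E] [∀ X : E, PreservesFiniteCoproducts (tensorLeft X)]

namespace PlanarOperad

theorem symm_hom_ext₂ (P : PlanarOperad.{w} E) {c c' : Tuple P.Col} {x y : P.Col} {Z : E}
    {f g : P.symmObj c x ⊗ P.symmObj c' y ⟶ Z}
    (h : ∀ (e e' : Tuple P.Col) (σ : Fin c.len ≃ Fin e.len) (hσ : ∀ p, e.col (σ p) = c.col p)
      (μ : Fin c'.len ≃ Fin e'.len) (hμ : ∀ p, e'.col (μ p) = c'.col p),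
      (P.incl σ hσ ⊗ₘ P.incl μ hμ) ≫ f = (P.incl σ hσ ⊗ₘ P.incl μ hμ) ≫ g) : f = g :=
  tensor_hom_ext fun σ μ => by rw [ι_eq_incl, ι_eq_incl]; exact h _ _ _ _ _ _

theorem symm_hom_ext₃ (P : PlanarOperad.{w} E) {c c' c'' : Tuple P.Col} {x y z : P.Col} {Z : E}
    {f g : (P.symmObj c x ⊗ P.symmObj c' y) ⊗ P.symmObj c'' z ⟶ Z}
    (h : ∀ (e e' e'' : Tuple P.Col) (σ : Fin c.len ≃ Fin e.len)
      (hσ : ∀ p, e.col (σ p) = c.col p)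
      (μ : Fin c'.len ≃ Fin e'.len) (hμ : ∀ p, e'.col (μ p) = c'.col p)
      (ν : Fin c''.len ≃ Fin e''.len) (hν : ∀ p, e''.col (ν p) = c''.col p),
      ((P.incl σ hσ ⊗ₘ P.incl μ hμ) ⊗ₘ P.incl ν hν) ≫ f =
        ((P.incl σ hσ ⊗ₘ P.incl μ hμ) ⊗ₘ P.incl ν hν) ≫ g) : f = g :=
  tensor_hom_ext₃ fun σ μ ν => by
    rw [ι_eq_incl, ι_eq_incl, ι_eq_incl]; exact h _ _ _ _ _ _ _ _ _

theorem blockPerm_one_left {n n' : ℕ} (σ : Fin n ≃ Fin n') (p : Fin n) (q : Fin (1 + n - 1))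
    (h : (p : ℕ) = q) :
    (σ p : ℕ) = blockPerm (Equiv.refl (Fin 1)) 0 σ q := by
  revert q
  refine slot_cases (n := 1) 0 ?_ ?_
  · intro j hj; exact absurd (Subsingleton.elim _ _) hj
  · intro k hk
    obtain rfl : p = k := Fin.ext (hk.trans (by simp [inner_val]))
    rw [blockPerm_inner]
    simp [inner_val]

theorem blockPerm_one_right {n n' : ℕ} (σ : Fin n ≃ Fin n') (i : Fin n) (p : Fin n)
    (q : Fin (n + 1 - 1)) (h : (p : ℕ) = q) :
    (σ p : ℕ) = blockPerm σ i (Equiv.refl (Fin 1)) q := by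
  have aux : ∀ {n : ℕ} (i j : Fin n) (h : j ≠ i), (outer i 1 j h : ℕ) = j := by
    intro n i j h
    rw [outer_val]; split_ifs <;> omega
  revert q
  refine slot_cases (m := 1) i ?_ ?_
  · intro j hj hk
    obtain rfl : p = j := Fin.ext (hk.trans (aux _ _ _))
    rw [blockPerm_outer, aux]
  · intro k hk
    obtain rfl : p = i := Fin.ext (hk.trans (by rw [inner_val]; omega))
    rw [blockPerm_inner, inner_val]
    omega

theorem blockPerm_trans {n n' n'' m m' m'' : ℕ} (σ : Fin n ≃ Fin n') (τ : Fin n' ≃ Fin n'')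
    (i : Fin n) (μ : Fin m ≃ Fin m') (ρ : Fin m' ≃ Fin m'') (p : Fin (n + m - 1)) :
    (blockPerm σ i μ).trans (blockPerm τ (σ i) ρ) p = blockPerm (σ.trans τ) i (μ.trans ρ) p := by
  revert p
  refine slot_cases i ?_ ?_
  · intro j hj
    rw [blockPerm_outer, Equiv.trans_apply, blockPerm_outer, blockPerm_outer]
    rfl
  · intro k
    rw [blockPerm_inner, Equiv.trans_apply, blockPerm_inner, blockPerm_inner]
    rfl

variable (P : PlanarOperad.{w} E)

/-- The units of `P_S`. -/
noncomputable def symmOne (x : P.Col) : 𝟙_ E ⟶ P.symmObj (Tuple.single x) x :=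
  P.one x ≫ P.incl (c := Tuple.single x) (e := Tuple.single x) (Equiv.refl _) fun _ => rfl

theorem symm_one_circ (c : Tuple P.Col) (x : P.Col) :
    P.symmOne x ▷ P.symmObj c x ≫
        P.symmCirc (c := Tuple.single x) (0 : Fin 1) rfl (Tuple.single_insert x c) =
      (λ_ (P.symmObj c x)).hom := by
  rw [symmOne]
  refine left_hom_ext fun σ => ?_
  rw [ι_eq_incl, comp_whiskerRight, Category.assoc, whisker_exchange_assoc,
    ← MonoidalCategory.tensorHom_def'_assoc,
    P.incl_symmCirc (c := Tuple.single x) (e := Tuple.single x) (0 : Fin 1) rfl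
      (Tuple.single_insert x c) (Equiv.refl _) (fun _ => rfl) (e' := c.perm σ⁻¹) σ
      (perm_inv_col c σ) rfl (Tuple.single_insert x _) σ
      (fun p q h => blockPerm_one_left σ p q h) (perm_inv_col c σ),
    leftUnitor_naturality]
  exact (Category.assoc _ _ _).symm.trans (congrArg (· ≫ _) (P.one_circ (c.perm σ⁻¹) x))

theorem symm_circ_one (c : Tuple P.Col) (x : P.Col) (i : Fin c.len) (y : P.Col)
    (hy : c.col i = y) :
    P.symmObj c x ◁ P.symmOne y ≫ P.symmCirc i hy (Tuple.insert_single c i hy) =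
      (ρ_ (P.symmObj c x)).hom := by
  rw [symmOne]
  refine right_hom_ext fun σ => ?_
  have hy' : (c.perm σ⁻¹).col (σ i) = y := (perm_inv_col c σ i).trans hy
  rw [ι_eq_incl, whiskerLeft_comp, Category.assoc, ← whisker_exchange_assoc,
    ← MonoidalCategory.tensorHom_def_assoc,
    P.incl_symmCirc (c' := Tuple.single y) (e' := Tuple.single y) i hy
      (Tuple.insert_single c i hy) (e := c.perm σ⁻¹) σ (perm_inv_col c σ)
      (Equiv.refl _) (fun _ => rfl) hy' (Tuple.insert_single (c.perm σ⁻¹) (σ i) hy') σ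
      (fun p q h => blockPerm_one_right σ i p q h) (perm_inv_col c σ),
    rightUnitor_naturality]
  exact (Category.assoc _ _ _).symm.trans
    (congrArg (· ≫ _) (P.circ_one (c.perm σ⁻¹) x (σ i) y hy'))

theorem symm_circ_circ_inner (c : Tuple P.Col) (x : P.Col) (c' : Tuple P.Col) (y : P.Col)
    (c'' : Tuple P.Col) (z : P.Col) (d : Tuple P.Col) (i : Fin c.len) (hy : c.col i = y)
    (j : Fin c'.len) (hz : c'.col j = z) (hd : c.insert i (c'.insert j c'') = d) :
    (P.symmCirc (x := x) i hy (rfl : c.insert i c' = _) ▷ P.symmObj c'' z) ≫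
        P.symmCirc (inner i j) ((Tuple.insert_col_inner c i c' j).trans hz)
          ((Tuple.insert_insert_inner c i c' j c'').trans hd) =
      (α_ _ _ _).hom ≫ (P.symmObj c x ◁ P.symmCirc j hz rfl) ≫ P.symmCirc i hy hd := by
  subst hd
  refine P.symm_hom_ext₃ fun e e' e'' σ hσ μ hμ ν hν => ?_
  have e₁ := blockPerm_inner σ i μ j
  have hy' : e.col (σ i) = y := (hσ i).trans hy
  have hz' : e'.col (μ j) = z := (hμ j).trans hz
  have col₁ := blockPerm_col (e := e) (e' := e') σ hσ i μ hμ
  have col₂ := blockPerm_col (e := e') (e' := e'') μ hμ j ν hν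
  have col₄ := blockPerm_col (e := e) (c' := c'.insert j c'') (e' := e'.insert (μ j) e'')
    σ hσ i (blockPerm μ j ν) col₂
  rw [tensorHom_comp_whiskerRight_assoc,
    P.incl_symmCirc i hy rfl σ hσ μ hμ hy' rfl (blockPerm σ i μ)
      (fun p q h => by rw [Fin.ext h]) col₁,
    ← whiskerRight_comp_tensorHom, Category.assoc,
    P.incl_symmCirc (c := c.insert i c') (d := c.insert i (c'.insert j c'')) (inner i j)
      ((Tuple.insert_col_inner c i c' j).trans hz) (Tuple.insert_insert_inner c i c' j c'')
      (e := e.insert (σ i) e') (blockPerm σ i μ) col₁ ν hν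
      ((col₁ _).trans ((Tuple.insert_col_inner c i c' j).trans hz))
      (f := e.insert (σ i) (e'.insert (μ j) e''))
      ((congrArg (fun p => (e.insert (σ i) e').insert p e'') e₁).trans
        (Tuple.insert_insert_inner e (σ i) e' (μ j) e''))
      (blockPerm σ i (blockPerm μ j ν))
      (fun p q h => (blockPerm_blockPerm_inner σ i μ j ν q p h.symm).symm) col₄]
  rw [associator_naturality_assoc, tensorHom_comp_whiskerLeft_assoc,
    P.incl_symmCirc j hz rfl μ hμ ν hν hz' rfl (blockPerm μ j ν)
      (fun p q h => by rw [Fin.ext h]) col₂,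
    ← whiskerLeft_comp_tensorHom, Category.assoc,
    P.incl_symmCirc (c' := c'.insert j c'') i hy rfl σ hσ (e' := e'.insert (μ j) e'')
      (blockPerm μ j ν) col₂ hy' rfl (blockPerm σ i (blockPerm μ j ν))
      (fun p q h => by rw [Fin.ext h]) col₄,
    ← Category.assoc,
    P.circ_circ_inner' (σ i) hy' (μ j) hz' rfl _ (congrArg Fin.val e₁) _ _ rfl rfl]
  simp only [Category.assoc]

theorem symm_circ_circ_outer (c : Tuple P.Col) (x : P.Col) (c' : Tuple P.Col) (y : P.Col)
    (c'' : Tuple P.Col) (z : P.Col) (d : Tuple P.Col) (i k : Fin c.len) (h : k ≠ i)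
    (hy : c.col i = y) (hz : c.col k = z)
    (hd : (c.insert k c'').insert (outer k c''.len i h.symm) c' = d) :
    (P.symmCirc (x := x) i hy (rfl : c.insert i c' = _) ▷ P.symmObj c'' z) ≫
        P.symmCirc (outer i c'.len k h) ((Tuple.insert_col_outer c i c' k h).trans hz)
          ((Tuple.insert_insert_outer c i k h c' c'').trans hd) =
      (α_ _ _ _).hom ≫ (P.symmObj c x ◁ (β_ (P.symmObj c' y) (P.symmObj c'' z)).hom) ≫
        (α_ _ _ _).inv ≫ (P.symmCirc (x := x) k hz (rfl : c.insert k c'' = _) ▷ P.symmObj c' y) ≫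
          P.symmCirc (outer k c''.len i h.symm)
            ((Tuple.insert_col_outer c k c'' i h.symm).trans hy) hd := by
  subst hd
  refine P.symm_hom_ext₃ fun e e' e'' σ hσ μ hμ ν hν => ?_
  have hi : σ k ≠ σ i := σ.injective.ne h
  have e₁ := blockPerm_outer σ i μ k h
  have e₂ := blockPerm_outer σ k ν i h.symm
  have hy' : e.col (σ i) = y := (hσ i).trans hy
  have hz' : e.col (σ k) = z := (hσ k).trans hz
  have col₁ := blockPerm_col (e := e) (e' := e') σ hσ i μ hμ
  have col₂ := blockPerm_col (e := e) (e' := e'') σ hσ k ν hν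
  have col₄ := blockPerm_col (c := c.insert k c'') (e := e.insert (σ k) e'') (e' := e')
    (blockPerm σ k ν) col₂ (outer k c''.len i h.symm) μ hμ
  rw [tensorHom_comp_whiskerRight_assoc,
    P.incl_symmCirc i hy rfl σ hσ μ hμ hy' rfl (blockPerm σ i μ)
      (fun p q h => by rw [Fin.ext h]) col₁,
    ← whiskerRight_comp_tensorHom, Category.assoc,
    P.incl_symmCirc (c := c.insert i c')
      (d := (c.insert k c'').insert (outer k c''.len i h.symm) c') (outer i c'.len k h)
      ((Tuple.insert_col_outer c i c' k h).trans hz)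
      (Tuple.insert_insert_outer c i k h c' c'')
      (e := e.insert (σ i) e') (blockPerm σ i μ) col₁ ν hν
      ((col₁ _).trans ((Tuple.insert_col_outer c i c' k h).trans hz))
      (f := (e.insert (σ k) e'').insert (blockPerm σ k ν (outer k c''.len i h.symm)) e')
      ((congrArg (fun p => (e.insert (σ i) e').insert p e'') e₁).trans
        ((Tuple.insert_insert_outer e (σ i) (σ k) hi e' e'').trans
          (congrArg (fun p => (e.insert (σ k) e'').insert p e') e₂.symm)))
      (blockPerm (blockPerm σ k ν) (outer k c''.len i h.symm) μ)
      (fun p q hpq => (blockPerm_blockPerm_outer σ i k h μ ν q p hpq.symm).symm) col₄,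
    ← Category.assoc,
    P.circ_circ_outer' (σ i) (σ k) hi hy' hz' rfl _ (congrArg Fin.val e₁) _ _ rfl
      (blockPerm σ k ν (outer k c''.len i h.symm)) (congrArg Fin.val e₂)
      ((col₂ _).trans ((Tuple.insert_col_outer c k c'' i h.symm).trans hy)) rfl]
  rw [associator_naturality_assoc, tensorHom_comp_whiskerLeft_assoc,
    BraidedCategory.braiding_naturality, ← whiskerLeft_comp_tensorHom_assoc,
    associator_inv_naturality_assoc, tensorHom_comp_whiskerRight_assoc,
    P.incl_symmCirc k hz rfl σ hσ ν hν hz' rfl (blockPerm σ k ν)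
      (fun p q h => by rw [Fin.ext h]) col₂,
    ← whiskerRight_comp_tensorHom, Category.assoc (_ ▷ _) (_ ⊗ₘ _),
      P.incl_symmCirc (c := c.insert k c'') (outer k c''.len i h.symm)
      ((Tuple.insert_col_outer c k c'' i h.symm).trans hy) rfl
      (e := e.insert (σ k) e'') (blockPerm σ k ν) col₂ μ hμ
      ((col₂ _).trans ((Tuple.insert_col_outer c k c'' i h.symm).trans hy)) rfl
      (blockPerm (blockPerm σ k ν) (outer k c''.len i h.symm) μ)
      (fun p q h => by rw [Fin.ext h]) col₄]
  simp only [exch, Category.assoc]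

theorem symm_act_one (c : Tuple P.Col) (x : P.Col) :
    P.symmAct (x := x) (1 : Equiv.Perm (Fin c.len)) (rfl : c.perm 1 = c) =
      𝟙 (P.symmObj c x) := by
  refine P.symm_hom_ext fun e σ hσ => ?_
  exact (P.incl_symmAct 1 (rfl : c.perm 1 = c) σ hσ σ
    (fun p q h => by rw [Fin.ext h]; rfl) hσ).trans (Category.comp_id _).symm

theorem symm_act_act (c : Tuple P.Col) (x : P.Col) (σ μ : Equiv.Perm (Fin c.len)) :
    P.symmAct (x := x) σ (rfl : c.perm σ = _) ≫
        P.symmAct (c := c.perm σ) μ (rfl : (c.perm σ).perm μ = _) =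
      P.symmAct (σ * μ) (rfl : c.perm (σ * μ) = (c.perm σ).perm μ) := by
  refine P.symm_hom_ext fun e ν hν => ?_
  refine (Category.assoc _ _ _).symm.trans ?_
  refine (congrArg (· ≫ _) (P.incl_symmAct σ rfl ν hν (σ.trans ν)
    (fun p q h => by rw [Fin.ext h]; rfl) (fun p => hν _))).trans ?_
  refine (P.incl_symmAct (c := c.perm σ) μ rfl (σ.trans ν) (fun p => hν _)
    (μ.trans (σ.trans ν)) (fun p q h => by rw [Fin.ext h]; rfl) (fun p => hν _)).trans ?_
  exact (P.incl_symmAct (σ * μ) rfl ν hν (μ.trans (σ.trans ν))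
    (fun p q h => by rw [Fin.ext h]; rfl) (fun p => hν _)).symm

theorem symm_act_circ (c : Tuple P.Col) (x : P.Col) (c' : Tuple P.Col) (y : P.Col)
    (σ : Equiv.Perm (Fin c.len)) (μ : Equiv.Perm (Fin c'.len)) (i : Fin c.len)
    (hy : c.col (σ i) = y) :
    (P.symmAct (x := x) σ (rfl : c.perm σ = _) ⊗ₘ P.symmAct (x := y) μ (rfl : c'.perm μ = _)) ≫
        P.symmCirc (c := c.perm σ) i hy (Tuple.perm_insert c σ i c' μ) =
      P.symmCirc (σ i) hy (rfl : c.insert (σ i) c' = _) ≫ P.symmAct (blockPerm σ i μ) rfl := by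
  refine P.symm_hom_ext₂ fun e e' τ hτ ρ hρ => ?_
  have col₁ := blockPerm_col (e := e) (e' := e') τ hτ (σ i) ρ hρ
  have hy' : e.col (τ (σ i)) = y := (hτ (σ i)).trans hy
  rw [tensorHom_comp_tensorHom_assoc,
    P.incl_symmAct σ rfl τ hτ (σ.trans τ) (fun p q h => by rw [Fin.ext h]; rfl) (fun p => hτ _),
    P.incl_symmAct μ rfl ρ hρ (μ.trans ρ) (fun p q h => by rw [Fin.ext h]; rfl) (fun p => hρ _)]
  refine (P.incl_symmCirc (c := c.perm σ) (c' := c'.perm μ) i hy (Tuple.perm_insert c σ i c' μ)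
    (σ.trans τ) (fun p => hτ _) (μ.trans ρ) (fun p => hρ _) hy'
    (rfl : e.insert (τ (σ i)) e' = _)
    ((blockPerm σ i μ).trans (blockPerm τ (σ i) ρ))
    (fun p q h => by rw [Fin.ext h, blockPerm_trans]) (fun p => col₁ _)).trans ?_
  rw [← Category.assoc (_ ⊗ₘ _), P.incl_symmCirc (σ i) hy rfl τ hτ ρ hρ hy' rfl
      (blockPerm τ (σ i) ρ) (fun p q h => by rw [Fin.ext h]) col₁, Category.assoc]
  have key := P.incl_symmAct (x := x) (c := c.insert (σ i) c') (e := e.insert (τ (σ i)) e')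
    (d := (c.insert (σ i) c').perm (blockPerm σ i μ)) (blockPerm σ i μ) rfl
    (blockPerm τ (σ i) ρ) col₁ ((blockPerm σ i μ).trans (blockPerm τ (σ i) ρ))
    (fun p q h => by obtain rfl := Fin.ext h; rfl) (fun p => col₁ _)
  exact congrArg (P.circ (x := x) (τ (σ i)) hy' (rfl : e.insert (τ (σ i)) e' = _) ≫ ·) key.symm

/-- The symmetrisation `P_S` of a planar operad `P`. -/
noncomputable abbrev symm (P : PlanarOperad.{w} E) : Operad.{w} E where
  Col := P.Col
  obj := P.symmObj
  circ i hy hd := P.symmCirc i hy hd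
  one := P.symmOne
  act μ hd := P.symmAct μ hd
  one_circ := P.symm_one_circ
  circ_one := P.symm_circ_one
  circ_circ_inner := P.symm_circ_circ_inner
  circ_circ_outer := P.symm_circ_circ_outer
  act_one := P.symm_act_one
  act_act := P.symm_act_act
  act_circ := P.symm_act_circ

end PlanarOperad
end ColouredOperad

namespace ColouredOperad

variable {E : Type u} [Category.{v} E] [MonoidalCategory E] [SymmetricCategory E]
  [HasFiniteCoproducts E] [∀ X : E, PreservesFiniteCoproducts (tensorLeft X)]

namespace PlanarOperad

/-- The map `P_S(c; x) ⟶ Q_S(f(c); f(x))` given by `f` on each summand. -/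
noncomputable def symmMapApp {P Q : PlanarOperad.{w} E} (f : P ⟶ Q) (c : Tuple P.Col)
    (x : P.Col) : P.symmObj c x ⟶ Q.symmObj (c.map f.onCol) (f.onCol x) :=
  Sigma.desc fun σ => f.app (c.perm σ⁻¹) x ≫
    Sigma.ι (fun τ : Equiv.Perm (Fin c.len) =>
      Q.obj ((c.map f.onCol).perm τ⁻¹) (f.onCol x)) σ

theorem incl_symmMapApp {P Q : PlanarOperad.{w} E} (f : P ⟶ Q) {c e : Tuple P.Col}
    {x : P.Col} (σ : Fin c.len ≃ Fin e.len) (hσ : ∀ p, e.col (σ p) = c.col p) :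
    P.incl σ hσ ≫ symmMapApp f c x =
      f.app e x ≫ Q.incl (c := c.map f.onCol) (e := e.map f.onCol) σ
        (fun p => congrArg f.onCol (hσ p)) := by
  obtain ⟨σ', rfl, h⟩ := P.incl_eq_ι σ hσ
  obtain rfl := (eq_of_heq h).symm
  rw [← ι_eq_incl, symmMapApp, Sigma.ι_desc]
  congr 1
  exact Q.ι_eq_incl (c := c.map f.onCol) (x := f.onCol x) _

theorem symmMap_one {P Q : PlanarOperad.{w} E} (f : P ⟶ Q) (x : P.Col) :
    P.symmOne x ≫ symmMapApp f (Tuple.single x) x = Q.symmOne (f.onCol x) := by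
  refine (Category.assoc _ _ _).trans ?_
  refine (congrArg (P.one x ≫ ·) (incl_symmMapApp f _ _)).trans ?_
  refine (Category.assoc _ _ _).symm.trans ?_
  exact congrArg (· ≫ _) (f.one_app x)

theorem symmMap_circ {P Q : PlanarOperad.{w} E} (f : P ⟶ Q) (c : Tuple P.Col) (x : P.Col)
    (c' : Tuple P.Col) (y : P.Col) (i : Fin c.len) (hy : c.col i = y) :
    P.symmCirc i hy (rfl : c.insert i c' = _) ≫ symmMapApp f (c.insert i c') x =
      (symmMapApp f c x ⊗ₘ symmMapApp f c' y) ≫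
        Q.symmCirc (c := c.map f.onCol) i (congrArg f.onCol hy)
          (Tuple.map_insert f.onCol c i c') := by
  refine P.symm_hom_ext₂ fun e e' σ hσ μ hμ => ?_
  have hy' : e.col (σ i) = y := (hσ i).trans hy
  have col := blockPerm_col (e := e) (e' := e') σ hσ i μ hμ
  rw [tensorHom_comp_tensorHom_assoc, incl_symmMapApp, incl_symmMapApp,
    ← tensorHom_comp_tensorHom, Category.assoc,
    Q.incl_symmCirc (c := c.map f.onCol) (c' := c'.map f.onCol) i (congrArg f.onCol hy)
      (Tuple.map_insert f.onCol c i c') (e := e.map f.onCol) (e' := e'.map f.onCol)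
      (f := (e.insert (σ i) e').map f.onCol) σ
      _ μ _ (congrArg f.onCol hy') (Tuple.map_insert f.onCol e (σ i) e') (blockPerm σ i μ)
      (fun p q h => by obtain rfl := Fin.ext h; rfl)
      (fun p => congrArg f.onCol (col p)),
    ← Category.assoc, P.incl_symmCirc i hy rfl σ hσ μ hμ hy' (rfl : e.insert (σ i) e' = _)
      (blockPerm σ i μ) (fun p q h => by rw [Fin.ext h]) col, Category.assoc]
  refine (congrArg (P.circ (x := x) (σ i) hy' (rfl : e.insert (σ i) e' = _) ≫ ·)
    (incl_symmMapApp f _ col)).trans ?_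
  refine (Category.assoc _ _ _).symm.trans ?_
  refine (congrArg (· ≫ _) (f.circ_app e x e' y (σ i) hy')).trans ?_
  exact Category.assoc _ _ _

theorem symmMap_act {P Q : PlanarOperad.{w} E} (f : P ⟶ Q) (c : Tuple P.Col) (x : P.Col)
    (μ : Equiv.Perm (Fin c.len)) :
    P.symmAct μ (rfl : c.perm μ = _) ≫ symmMapApp f (c.perm μ) x =
      symmMapApp f c x ≫ Q.symmAct (c := c.map f.onCol) μ rfl := by
  refine P.symm_hom_ext fun e σ hσ => ?_
  refine (Category.assoc _ _ _).symm.trans ?_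
  refine (congrArg (· ≫ _) (P.incl_symmAct μ rfl σ hσ (μ.trans σ)
    (fun p q h => by obtain rfl := Fin.ext h; rfl) (fun p => hσ _))).trans ?_
  refine (incl_symmMapApp f (c := c.perm μ) (μ.trans σ) (fun p => hσ _)).trans ?_
  refine .trans ?_ (Category.assoc _ _ _)
  refine .trans ?_ (congrArg (· ≫ _) (incl_symmMapApp f σ hσ)).symm
  refine .trans ?_ (Category.assoc _ _ _).symm
  refine congrArg (f.app e x ≫ ·) ?_
  exact (Q.incl_symmAct (c := c.map f.onCol) (e := e.map f.onCol) μ rfl σ _ (μ.trans σ)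
    (fun p q h => by obtain rfl := Fin.ext h; rfl) (fun p => congrArg f.onCol (hσ _))).symm

/-- The morphism `P_S ⟶ Q_S` induced by a morphism of planar operads. -/
noncomputable def symmMap {P Q : PlanarOperad.{w} E} (f : P ⟶ Q) : P.symm ⟶ Q.symm where
  onCol := f.onCol
  app c x := symmMapApp f c x
  one_app := symmMap_one f
  circ_app := symmMap_circ f
  act_app := symmMap_act f

theorem symmMap_id (P : PlanarOperad.{w} E) : symmMap (𝟙 P) = 𝟙 P.symm := by
  refine Operad.Hom.ext_app rfl (heq_of_eq ?_)
  funext c x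
  refine P.symm_hom_ext fun e σ hσ => ?_
  refine (incl_symmMapApp (𝟙 P) σ hσ).trans ?_
  exact (Category.id_comp _).trans (Category.comp_id _).symm

theorem symmMap_comp {P Q R : PlanarOperad.{w} E} (f : P ⟶ Q) (g : Q ⟶ R) :
    symmMap (f ≫ g) = symmMap f ≫ symmMap g := by
  refine Operad.Hom.ext_app rfl (heq_of_eq ?_)
  funext c x
  refine P.symm_hom_ext fun e σ hσ => ?_
  refine (incl_symmMapApp (f ≫ g) σ hσ).trans ?_
  refine .trans ?_ (Category.assoc _ _ _)
  refine .trans ?_ (congrArg (· ≫ symmMapApp g (c.map f.onCol) (f.onCol x))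
    (incl_symmMapApp f σ hσ)).symm
  refine .trans ?_ (Category.assoc _ _ _).symm
  refine (Category.assoc _ _ _).trans ?_
  exact congrArg (f.app e x ≫ ·) (incl_symmMapApp g (c := c.map f.onCol)
    (e := e.map f.onCol) σ _).symm

variable (E) in
/-- The symmetrisation functor `P ↦ P_S`. -/
noncomputable def symmetrisation : PlanarOperad.{w} E ⥤ Operad.{w} E where
  obj := symm
  map := symmMap
  map_id := symmMap_id
  map_comp := symmMap_comp

variable (E) in
/-- The planar operad `uAs` with one colour and `n`-ary operations `𝟙`. -/
abbrev planarUAs : PlanarOperad.{w} E := Operad.uCom.toPlanarOperad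

variable (E) in
/-- The operad `uAs` of unital associative algebras, with one colour and
`uAs(n) = ∐_{σ ∈ Sₙ} 𝟙`. -/
noncomputable abbrev uAs : Operad.{w} E := (planarUAs E).symm

/-- The map `P_S(c; x) ⟶ P_S(c; x) ⊗ uAs(n)` which sends the summand `P(c^{σ⁻¹}; x) ⊗ {σ}`
to the summand `P(c^{σ⁻¹}; x) ⊗ {σ} ⊗ {σ}`. -/
noncomputable def coactApp (P : PlanarOperad.{w} E) (c : Tuple P.Col) (x : P.Col) :
    P.symmObj c x ⟶
      P.symmObj c x ⊗ (planarUAs.{w} E).symmObj (c.map fun _ => PUnit.unit) PUnit.unit :=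
  Sigma.desc fun σ => (ρ_ _).inv ≫
    (Sigma.ι (fun τ : Equiv.Perm (Fin c.len) => P.obj (c.perm τ⁻¹) x) σ ⊗ₘ
      Sigma.ι (fun _ : Equiv.Perm (Fin c.len) => 𝟙_ E) σ)

theorem incl_coactApp (P : PlanarOperad.{w} E) {c e : Tuple P.Col}
    {x : P.Col} (σ : Fin c.len ≃ Fin e.len) (hσ : ∀ p, e.col (σ p) = c.col p) :
    P.incl σ hσ ≫ P.coactApp c x =
      (ρ_ _).inv ≫ (P.incl σ hσ ⊗ₘ (planarUAs E).incl (x := PUnit.unit)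
        (c := c.map fun _ => PUnit.unit) (e := e.map fun _ => PUnit.unit) σ (fun _ => rfl)) := by
  obtain ⟨σ', rfl, h⟩ := P.incl_eq_ι σ hσ
  obtain rfl := (eq_of_heq h).symm
  rw [← ι_eq_incl, coactApp, Sigma.ι_desc]
  congr 2
  exact (planarUAs E).ι_eq_incl (c := c.map fun _ => PUnit.unit) (x := PUnit.unit) _

theorem rightUnitor_inv_circ {X Y Z : E} (p : X ⊗ Y ⟶ Z) :
    ((ρ_ X).inv ⊗ₘ (ρ_ Y).inv) ≫ tensorμ X (𝟙_ E) Y (𝟙_ E) ≫ (p ⊗ₘ (λ_ (𝟙_ E)).hom) =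
      p ≫ (ρ_ Z).inv :=
  (Operad.circ_inv (ρ_ X) (ρ_ Y) (ρ_ Z) (Operad.rightUnitor_circ p)).symm ▸ rfl

theorem coact_one (P : PlanarOperad.{w} E) (x : P.Col) :
    P.symmOne x ≫ P.coactApp (Tuple.single x) x =
      (λ_ (𝟙_ E)).inv ≫ (P.symmOne x ⊗ₘ (planarUAs.{w} E).symmOne PUnit.unit) := by
  refine (Category.assoc _ _ _).trans ?_
  refine (congrArg (P.one x ≫ ·) (incl_coactApp P _ _)).trans ?_
  refine (rightUnitor_inv_naturality_assoc (P.one x) _).trans ?_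
  rw [unitors_inv_equal, ← tensorHom_id]
  exact congrArg ((ρ_ (𝟙_ E)).inv ≫ ·) (tensorHom_comp_tensorHom (C := E) _ _ _ _)

theorem coact_circ (P : PlanarOperad.{w} E) (c : Tuple P.Col) (x : P.Col)
    (c' : Tuple P.Col) (y : P.Col) (i : Fin c.len) (hy : c.col i = y) :
    P.symmCirc i hy (rfl : c.insert i c' = _) ≫ P.coactApp (c.insert i c') x =
      (P.coactApp c x ⊗ₘ P.coactApp c' y) ≫ tensorμ _ _ _ _ ≫
        (P.symmCirc i hy (rfl : c.insert i c' = _) ⊗ₘ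
          (planarUAs.{w} E).symmCirc (x := PUnit.unit) (y := PUnit.unit)
            (c := c.map fun _ => PUnit.unit) (c' := c'.map fun _ => PUnit.unit)
            (d := (c.insert i c').map fun _ => PUnit.unit) i rfl
            (Tuple.map_insert _ c i c')) := by
  refine P.symm_hom_ext₂ fun e e' σ hσ μ hμ => ?_
  have hy' : e.col (σ i) = y := (hσ i).trans hy
  have col := blockPerm_col (e := e) (e' := e') σ hσ i μ hμ
  have h₁ := P.incl_symmCirc (x := x) i hy rfl σ hσ μ hμ hy' (rfl : e.insert (σ i) e' = _)
    (blockPerm σ i μ) (fun p q h => by rw [Fin.ext h]) col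
  have h₂ := (planarUAs.{w} E).incl_symmCirc (x := PUnit.unit) (y := PUnit.unit)
    (c := c.map fun _ => PUnit.unit)
    (c' := c'.map fun _ => PUnit.unit) (d := (c.insert i c').map fun _ => PUnit.unit) i rfl
    (Tuple.map_insert _ c i c') (e := e.map fun _ => PUnit.unit)
    (e' := e'.map fun _ => PUnit.unit) (f := (e.insert (σ i) e').map fun _ => PUnit.unit) σ
    (fun _ => rfl) μ (fun _ => rfl) rfl (Tuple.map_insert _ e (σ i) e') (blockPerm σ i μ)
    (fun p q h => by obtain rfl := Fin.ext h; rfl) (fun p => rfl)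
  rw [tensorHom_comp_tensorHom_assoc, incl_coactApp, incl_coactApp, ← tensorHom_comp_tensorHom,
    Category.assoc, ← Category.assoc, h₁, tensorμ_natural_assoc, tensorHom_comp_tensorHom, h₁, h₂,
    ← tensorHom_comp_tensorHom, Category.assoc]
  refine (congrArg (P.circ (x := x) (σ i) hy' (rfl : e.insert (σ i) e' = _) ≫ ·)
    (incl_coactApp P _ col)).trans ?_
  refine (Category.assoc _ _ _).symm.trans ?_
  refine (congrArg (· ≫ _) (rightUnitor_inv_circ _).symm).trans ?_
  simp only [Category.assoc]

theorem coact_act (P : PlanarOperad.{w} E) (c : Tuple P.Col) (x : P.Col)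
    (μ : Equiv.Perm (Fin c.len)) :
    P.symmAct μ (rfl : c.perm μ = _) ≫ P.coactApp (c.perm μ) x =
      P.coactApp c x ≫ (P.symmAct μ (rfl : c.perm μ = _) ⊗ₘ
        (planarUAs.{w} E).symmAct (x := PUnit.unit) (c := c.map fun _ => PUnit.unit) μ rfl) := by
  refine P.symm_hom_ext fun e σ hσ => ?_
  have h₁ := P.incl_symmAct (x := x) μ rfl σ hσ (μ.trans σ)
    (fun p q h => by obtain rfl := Fin.ext h; rfl) (fun p => hσ _)
  have h₂ := ((planarUAs.{w} E).incl_symmAct (x := PUnit.unit) (c := c.map fun _ => PUnit.unit)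
    (e := e.map fun _ => PUnit.unit) μ rfl σ (fun _ => rfl) (μ.trans σ)
    (fun p q h => by obtain rfl := Fin.ext h; rfl) (fun p => rfl))
  refine (Category.assoc _ _ _).symm.trans ?_
  refine (congrArg (· ≫ _) h₁).trans ?_
  refine (incl_coactApp P (c := c.perm μ) (μ.trans σ) (fun p => hσ _)).trans ?_
  refine .trans ?_ (Category.assoc _ _ _)
  refine .trans ?_ (congrArg (· ≫ _) (incl_coactApp P σ hσ)).symm
  refine .trans ?_ (Category.assoc _ _ _).symm
  refine congrArg ((ρ_ _).inv ≫ ·) ?_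
  refine .trans ?_ (tensorHom_comp_tensorHom _ _ _ _).symm
  exact (congrArg₂ (· ⊗ₘ ·) h₁ h₂).symm

/-- The coaction `P_S ⟶ P_S ⊗ uAs`. -/
noncomputable def coaction (P : PlanarOperad.{w} E) : P.symm ⟶ P.symm ⊗ uAs.{w} E where
  onCol x := (x, PUnit.unit)
  app c x := P.coactApp c x
  one_app := P.coact_one
  circ_app c x c' y i hy := P.coact_circ c x c' y i hy
  act_app := P.coact_act

variable (E) in
/-- The map `uAs(n) = ∐_{σ ∈ Sₙ} 𝟙 ⟶ 𝟙` which is the identity on each summand. -/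
noncomputable def counitApp (c : Tuple PUnit.{w + 1}) :
    (planarUAs.{w} E).symmObj c PUnit.unit ⟶ 𝟙_ E :=
  Sigma.desc fun _ => 𝟙 (𝟙_ E)

theorem incl_counitApp {c e : Tuple PUnit.{w + 1}} (σ : Fin c.len ≃ Fin e.len)
    (hσ : ∀ p, e.col (σ p) = c.col p) :
    (planarUAs.{w} E).incl (c := c) (e := e) (x := PUnit.unit) σ hσ ≫ counitApp E c =
      𝟙 (𝟙_ E) := by
  obtain ⟨σ', rfl, h⟩ := (planarUAs.{w} E).incl_eq_ι σ hσ
  obtain rfl := (eq_of_heq h).symm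
  rw [← ι_eq_incl, counitApp, Sigma.ι_desc]

theorem counit_circ (c c' : Tuple PUnit.{w + 1}) (i : Fin c.len) :
    (planarUAs.{w} E).symmCirc (x := PUnit.unit) (y := PUnit.unit) i rfl
        (rfl : c.insert i c' = _) ≫ counitApp E (c.insert i c') =
      (counitApp E c ⊗ₘ counitApp E c') ≫ (λ_ (𝟙_ E)).hom := by
  refine (planarUAs.{w} E).symm_hom_ext₂ fun e e' σ hσ μ hμ => ?_
  have h₁ := (planarUAs.{w} E).incl_symmCirc (x := PUnit.unit) (y := PUnit.unit) i rfl rfl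
    σ hσ μ hμ rfl (rfl : e.insert (σ i) e' = _)
    (blockPerm σ i μ) (fun p q h => by rw [Fin.ext h]) (fun _ => rfl)
  rw [← Category.assoc, h₁, tensorHom_comp_tensorHom_assoc, incl_counitApp, incl_counitApp,
    Category.assoc]
  refine (congrArg (_ ≫ ·) (incl_counitApp _ _)).trans ?_
  exact (Category.comp_id _).trans
    ((congrArg (· ≫ _) (id_tensorHom_id _ _)).trans (Category.id_comp _)).symm

theorem counit_act (c : Tuple PUnit.{w + 1}) (μ : Equiv.Perm (Fin c.len)) :
    (planarUAs.{w} E).symmAct (x := PUnit.unit) μ (rfl : c.perm μ = _) ≫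
      counitApp E (c.perm μ) = counitApp E c := by
  refine (planarUAs.{w} E).symm_hom_ext fun e σ hσ => ?_
  have h₁ := (planarUAs.{w} E).incl_symmAct (x := PUnit.unit) μ rfl σ hσ (μ.trans σ)
    (fun p q h => by obtain rfl := Fin.ext h; rfl) (fun p => rfl)
  rw [← Category.assoc, h₁, incl_counitApp σ hσ]
  exact incl_counitApp (E := E) (c := c.perm μ) _ _

/-- The counit `uAs ⟶ uCom`. -/
noncomputable def counit : uAs.{w} E ⟶ 𝟙_ (Operad.{w} E) where
  onCol x := x
  app c x := counitApp E c
  one_app x := (Category.assoc _ _ _).trans (congrArg (𝟙 _ ≫ ·) (incl_counitApp _ _) |>.trans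
    (Category.comp_id _))
  circ_app c x c' y i hy := counit_circ c c' i
  act_app c x μ := (counit_act c μ).trans (Category.comp_id _).symm

theorem coaction_counit (P : PlanarOperad.{w} E) :
    P.coaction ≫ P.symm ◁ counit = (ρ_ P.symm).inv := by
  refine Operad.Hom.ext_app rfl (heq_of_eq ?_)
  funext c x
  refine P.symm_hom_ext fun e σ hσ => ?_
  change P.incl σ hσ ≫ P.coactApp c x ≫ (𝟙 _ ⊗ₘ counitApp E (c.map fun _ => PUnit.unit)) =
    P.incl σ hσ ≫ (ρ_ _).inv
  rw [← Category.assoc, incl_coactApp, Category.assoc, tensorHom_comp_tensorHom,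
    incl_counitApp, Category.comp_id, tensorHom_id, rightUnitor_inv_naturality]

theorem coaction_coassoc (P : PlanarOperad.{w} E) :
    P.coaction ≫ P.symm ◁ (planarUAs.{w} E).coaction =
      P.coaction ≫ P.coaction ▷ uAs.{w} E ≫ (α_ _ _ _).hom := by
  refine Operad.Hom.ext_app rfl (heq_of_eq ?_)
  funext c x
  refine P.symm_hom_ext fun e σ hσ => ?_
  change P.incl σ hσ ≫ P.coactApp c x ≫
      (𝟙 _ ⊗ₘ (planarUAs.{w} E).coactApp (c.map fun _ => PUnit.unit) PUnit.unit) =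
    P.incl σ hσ ≫ P.coactApp c x ≫ (P.coactApp c x ⊗ₘ 𝟙 _) ≫ (α_ _ _ _).hom
  have h := P.incl_coactApp σ hσ (x := x)
  have h' := (planarUAs.{w} E).incl_coactApp (x := PUnit.unit)
    (c := c.map fun _ => PUnit.unit) (e := e.map fun _ => PUnit.unit) σ (fun _ => rfl)
  rw [← Category.assoc, h, Category.assoc, tensorHom_comp_tensorHom, h', Category.comp_id,
    ← Category.assoc, h, Category.assoc, tensorHom_comp_tensorHom_assoc, h, Category.comp_id]
  refine congrArg ((ρ_ _).inv ≫ ·) ?_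
  rw [← whiskerLeft_comp_tensorHom, ← whiskerRight_comp_tensorHom, Category.assoc,
    associator_naturality, ← Category.assoc]
  refine congrArg (· ≫ _) ?_
  simp

theorem coaction_natural {P Q : PlanarOperad.{w} E} (f : P ⟶ Q) :
    symmMap f ≫ Q.coaction = P.coaction ≫ symmMap f ▷ uAs.{w} E := by
  refine Operad.Hom.ext_app rfl (heq_of_eq ?_)
  funext c x
  refine P.symm_hom_ext fun e σ hσ => ?_
  change P.incl σ hσ ≫ symmMapApp f c x ≫ Q.coactApp (c.map f.onCol) (f.onCol x) =
    P.incl σ hσ ≫ P.coactApp c x ≫ (symmMapApp f c x ⊗ₘ 𝟙 _)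
  rw [← Category.assoc, incl_symmMapApp, Category.assoc,
    Q.incl_coactApp (c := c.map f.onCol) (e := e.map f.onCol), ← Category.assoc, ← Category.assoc,
    incl_coactApp, Category.assoc, Category.assoc, tensorHom_comp_tensorHom, Category.comp_id,
    incl_symmMapApp,
    rightUnitor_inv_naturality_assoc, whiskerRight_comp_tensorHom]

/-- The Hopf operad structure of `uAs`: its comultiplication sends the summand `{σ}` to the
summand `{σ} ⊗ {σ}`. -/
noncomputable instance : ComonObj (uAs.{w} E) where
  counit := counit
  comul := (planarUAs.{w} E).coaction
  counit_comul := by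
    refine Operad.Hom.ext_app rfl (heq_of_eq ?_)
    funext c x
    refine (planarUAs.{w} E).symm_hom_ext fun e σ hσ => ?_
    change (planarUAs.{w} E).incl σ hσ ≫ (planarUAs.{w} E).coactApp c x ≫
      (counitApp E c ⊗ₘ 𝟙 _) = (planarUAs.{w} E).incl σ hσ ≫ (λ_ _).inv
    rw [← Category.assoc, incl_coactApp, Category.assoc, tensorHom_comp_tensorHom,
      incl_counitApp, Category.comp_id, id_tensorHom, leftUnitor_inv_naturality,
      unitors_inv_equal]
  comul_counit := (planarUAs.{w} E).coaction_counit
  comul_assoc := (planarUAs.{w} E).coaction_coassoc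

end PlanarOperad
end ColouredOperad

namespace ColouredOperad

section Comodule

variable {C : Type u} [Category.{v} C] [MonoidalCategory C]

/-- Right comodules over a comonoid `A`. -/
structure Comodule (A : C) [ComonObj A] where
  X : C
  coact : X ⟶ X ⊗ A
  coact_counit : coact ≫ X ◁ ComonObj.counit = (ρ_ X).inv
  coact_comul : coact ≫ X ◁ ComonObj.comul = coact ≫ coact ▷ A ≫ (α_ X A A).hom

/-- Morphisms of comodules: the morphisms which commute with the coactions. -/
structure Comodule.Hom {A : C} [ComonObj A] (M N : Comodule A) where
  hom : M.X ⟶ N.X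
  hom_coact : hom ≫ N.coact = M.coact ≫ hom ▷ A

theorem Comodule.Hom.ext_hom {A : C} [ComonObj A] {M N : Comodule A} {f g : Comodule.Hom M N}
    (h : f.hom = g.hom) : f = g := by
  cases f
  cases g
  cases h
  rfl

instance (A : C) [ComonObj A] : Category (Comodule A) where
  Hom := Comodule.Hom
  id M := ⟨𝟙 M.X, by rw [Category.id_comp, id_whiskerRight, Category.comp_id]⟩
  comp f g := ⟨f.hom ≫ g.hom, by
    rw [Category.assoc, g.hom_coact, ← Category.assoc, f.hom_coact, Category.assoc,
      comp_whiskerRight]⟩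
  id_comp f := Comodule.Hom.ext_hom (Category.id_comp _)
  comp_id f := Comodule.Hom.ext_hom (Category.comp_id _)
  assoc f g h := Comodule.Hom.ext_hom (Category.assoc _ _ _)

end Comodule

/-- The functor `P ↦ P_S` from planar operads to `uAs`-comodules in operads. -/
noncomputable def planarToComodule (E : Type u) [Category.{v} E] [MonoidalCategory E]
    [SymmetricCategory E] [HasFiniteCoproducts E]
    [∀ X : E, PreservesFiniteCoproducts (tensorLeft X)] :
    PlanarOperad.{w} E ⥤ Comodule (PlanarOperad.uAs.{w} E) where
  obj P :=
    { X := P.symm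
      coact := P.coaction
      coact_counit := P.coaction_counit
      coact_comul := P.coaction_coassoc }
  map f := ⟨PlanarOperad.symmMap f, PlanarOperad.coaction_natural f⟩
  map_id P := Comodule.Hom.ext_hom (PlanarOperad.symmMap_id P)
  map_comp f g := Comodule.Hom.ext_hom (PlanarOperad.symmMap_comp f g)

end ColouredOperad

/-!
The idea is that a coaction of `uAs` is a grading. Since `X ⊗ -` preserves finite coproducts,
`X ⊗ uAs(n)` is a coproduct of copies of `X` indexed by `Sₙ`. A coaction on an operad `M` thus
consists of morphisms `δ : M(c; x) ⟶ ∐_{σ ∈ Sₙ} M(c; x)`, and a morphism into `M(c; x)` is called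
homogeneous of degree `σ` if `δ` sends it into the summand `σ` (`IsHomogeneous`).

Let `part δ σ` be the pullback of `δ` along the coprojection of degree `σ`. Counitality makes
`part δ σ` the universal homogeneous object of degree `σ` over `M(c; x)` (`isHomogeneous_partι`,
`IsHomogeneous.lift`), and pullback-stability of coproducts makes `M(c; x)` the coproduct of its
homogeneous parts (`isIso_desc_partι`). Conversely, if `M(c; x)` is in any way a coproduct of
objects with homogeneous coprojections, one for each degree, then disjointness shows that these
summands are the homogeneous parts (`IsHomogeneous.exists_lift`).

*Full faithfulness.* In `P_S` the summand `P(c; x)` indexed by the identity is the part of degree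
`1`, so a morphism `P_S ⟶ Q_S` of comodules restricts to morphisms `P(c; x) ⟶ Q(f(c); f(x))`. They
form a morphism of planar operads, because the coprojections of `Q_S` are monomorphisms; and they
determine the given morphism, because the symmetric groups permute the summands of `P_S`
transitively (`symm_app_ext`, `exists_symmMap_eq`, `symmMap_injective`).

*Essential surjectivity.* Let `M` be a comodule. As the coaction is a morphism of operads, the units
are homogeneous of degree `1`, composites of operations of degree `1` have degree `1`, and `μ^*`
sends degree `σ` to degree `σμ`. Hence the parts of degree `1` form a planar operad
(`UAsCoaction.planarPart`), and `σ^*` identifies the part of degree `1` of `M(c^{σ⁻¹}; x)` with the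
part of degree `σ` of `M(c; x)`. So the morphism `UAsCoaction.fromSymm` from the symmetrisation of
this planar operad to `M` is an isomorphism (`UAsCoaction.isIso_fromSymmApp`).
-/

/-! ### Homogeneous morphisms -/

namespace ColouredOperad

section Disjoint

variable {E : Type u} [Category.{v} E] [HasFiniteCoproducts E] {G : Type} [Finite G]

theorem monoCoprod_of_disjoint [BinaryCoproductsDisjoint E] : MonoCoprod E :=
  ⟨fun _ _ _ hc => Mono.cofanInl_of_binaryCoproductDisjoint hc⟩

/-- Finite coproducts are disjoint as soon as binary ones are: the coproduct maps to the binary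
coproduct of one summand and the sum of the others. -/
theorem isInitial_of_comp_inj_eq [FinitaryPreExtensive E] [BinaryCoproductsDisjoint E] {X : E}
    {c : Cofan fun _ : G => X} (hc : IsColimit c) {σ τ : G} (h : σ ≠ τ) {Z : E} (a b : Z ⟶ X)
    (hab : a ≫ c.inj σ = b ≫ c.inj τ) : Nonempty (IsInitial Z) := by
  classical
  let q : c.pt ⟶ X ⨿ X :=
    Cofan.IsColimit.desc hc fun ρ => if ρ = σ then coprod.inl else coprod.inr
  have hσ : c.inj σ ≫ q = coprod.inl := (Cofan.IsColimit.fac hc _ σ).trans (if_pos rfl)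
  have hτ : c.inj τ ≫ q = coprod.inr := (Cofan.IsColimit.fac hc _ τ).trans (if_neg h.symm)
  have e : a ≫ (coprod.inl : X ⟶ X ⨿ X) = b ≫ coprod.inr := by
    rw [← hσ, ← hτ, reassoc_of% hab]
  exact ⟨IsInitial.ofStrict (pullback.lift a b e) IsInitial.ofBinaryCoproductDisjoint⟩

end Disjoint

section Homogeneous

variable {E : Type u} [Category.{v} E] [MonoidalCategory E] [SymmetricCategory E]
  [HasFiniteCoproducts E] [∀ X : E, PreservesFiniteCoproducts (tensorLeft X)]
variable {G : Type} [Finite G] {X Z : E}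

/-- A morphism `g` into an object with a coaction `δ` of `∐_{σ ∈ G} 𝟙` is homogeneous of degree
`σ` if `δ` sends it into the summand indexed by `σ`. -/
def IsHomogeneous (δ : X ⟶ X ⊗ ∐ fun _ : G => 𝟙_ E) (σ : G) (g : Z ⟶ X) : Prop :=
  g ≫ δ = (ρ_ Z).inv ≫ (g ⊗ₘ Sigma.ι (fun _ : G => 𝟙_ E) σ)

/-- The coprojection `X ⟶ X ⊗ ∐_{σ ∈ G} 𝟙` of the summand indexed by `σ`. -/
noncomputable abbrev copowerι (X : E) (σ : G) : X ⟶ X ⊗ ∐ fun _ : G => 𝟙_ E :=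
  (ρ_ X).inv ≫ X ◁ Sigma.ι (fun _ : G => 𝟙_ E) σ

theorem isHomogeneous_iff {δ : X ⟶ X ⊗ ∐ fun _ : G => 𝟙_ E} {σ : G} {g : Z ⟶ X} :
    IsHomogeneous δ σ g ↔ g ≫ δ = g ≫ copowerι X σ := by
  rw [IsHomogeneous, MonoidalCategory.tensorHom_def, ← rightUnitor_inv_naturality_assoc]

theorem IsHomogeneous.comp {δ : X ⟶ X ⊗ ∐ fun _ : G => 𝟙_ E} {σ : G} {g : Z ⟶ X}
    (hg : IsHomogeneous δ σ g) {W : E} (f : W ⟶ Z) : IsHomogeneous δ σ (f ≫ g) := by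
  rw [isHomogeneous_iff] at *
  rw [Category.assoc, hg, Category.assoc]

variable (G X) in
/-- `X ⊗ ∐_{σ ∈ G} 𝟙` is the coproduct of copies of `X` indexed by `G`. -/
noncomputable def copowerColim :
    IsColimit (Cofan.mk (X ⊗ ∐ fun _ : G => 𝟙_ E) (copowerι X)) :=
  Cofan.IsColimit.mk _
    (fun s => Cofan.IsColimit.desc (leftColim X fun _ : G => 𝟙_ E) fun σ => (ρ_ X).hom ≫ s.inj σ)
    (fun s σ => by
      have h : X ◁ Sigma.ι (fun _ : G => 𝟙_ E) σ ≫
          Cofan.IsColimit.desc (leftColim X fun _ : G => 𝟙_ E)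
            (fun σ => (ρ_ X).hom ≫ s.inj σ) = (ρ_ X).hom ≫ s.inj σ :=
        Cofan.IsColimit.fac (leftColim X fun _ : G => 𝟙_ E) _ σ
      change ((ρ_ X).inv ≫ _) ≫ _ = _
      rw [Category.assoc, h, Iso.inv_hom_id_assoc])
    (fun s m hm => left_hom_ext fun σ => by
      have h : X ◁ Sigma.ι (fun _ : G => 𝟙_ E) σ ≫
          Cofan.IsColimit.desc (leftColim X fun _ : G => 𝟙_ E)
            (fun σ => (ρ_ X).hom ≫ s.inj σ) = (ρ_ X).hom ≫ s.inj σ :=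
        Cofan.IsColimit.fac (leftColim X fun _ : G => 𝟙_ E) _ σ
      rw [h, ← hm σ]
      change _ = (ρ_ X).hom ≫ ((ρ_ X).inv ≫ _) ≫ _
      rw [Category.assoc, Iso.hom_inv_id_assoc])

/-- If `X` is the coproduct of objects with homogeneous coprojections, one for each degree, then
every homogeneous morphism into `X` factors through the coprojection of its degree. -/
theorem IsHomogeneous.exists_lift [FinitaryPreExtensive E] [BinaryCoproductsDisjoint E]
    {δ : X ⟶ X ⊗ ∐ fun _ : G => 𝟙_ E} {Y : G → E} {y : ∀ σ, Y σ ⟶ X}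
    (hc : IsIso (Sigma.desc y)) (hy : ∀ σ, IsHomogeneous δ σ (y σ)) {σ : G} {g : Z ⟶ X}
    (hg : IsHomogeneous δ σ g) : ∃ k : Z ⟶ Y σ, k ≫ y σ = g := by
  classical
  have hZ := FinitaryPreExtensive.isIso_sigmaDesc_fst y g hc
  -- The part of `Z` which lies over a summand of degree `τ ≠ σ` is initial.
  have hi : ∀ τ, τ ≠ σ → Nonempty (IsInitial (pullback g (y τ))) := fun τ hτ => by
    refine isInitial_of_comp_inj_eq (copowerColim G X) hτ (pullback.fst g (y τ) ≫ g)
      (pullback.fst g (y τ) ≫ g) ?_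
    have h₁ := isHomogeneous_iff.1 (hg.comp (pullback.fst g (y τ)))
    have h₂ := isHomogeneous_iff.1 ((hy τ).comp (pullback.snd g (y τ)))
    rw [← pullback.condition] at h₂
    exact h₂.symm.trans h₁
  let k : ∀ τ, pullback g (y τ) ⟶ Y σ := fun τ =>
    if h : τ = σ then pullback.snd g (y τ) ≫ eqToHom (congrArg Y h) else (hi τ h).some.to _
  refine ⟨inv (Sigma.desc fun τ => pullback.fst g (y τ)) ≫ Sigma.desc k, ?_⟩
  rw [Category.assoc, IsIso.inv_comp_eq]
  refine Sigma.hom_ext _ _ fun τ => ?_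
  rw [Sigma.ι_desc_assoc, Sigma.ι_desc_assoc]
  by_cases h : τ = σ
  · subst h
    simp only [k, dite_true, eqToHom_refl, Category.comp_id]
    exact pullback.condition.symm
  · exact (hi τ h).some.hom_ext _ _

variable (δ : X ⟶ X ⊗ ∐ fun _ : G => 𝟙_ E)

instance [FinitaryPreExtensive E] (σ : G) : HasPullback δ (copowerι X σ) :=
  FinitaryPreExtensive.hasPullbacks_of_is_coproduct (copowerColim G X) ⟨σ⟩ δ

/-- The homogeneous part of degree `σ` of an object `X` with a coaction of `∐_{σ ∈ G} 𝟙`. -/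
noncomputable def part [FinitaryPreExtensive E] (σ : G) : E := pullback δ (copowerι X σ)

/-- The inclusion of the homogeneous part of degree `σ`. -/
noncomputable def partι [FinitaryPreExtensive E] (σ : G) : part δ σ ⟶ X :=
  pullback.fst δ (copowerι X σ)

variable (E G) in
/-- The codiagonal `∐_{σ ∈ G} 𝟙 ⟶ 𝟙`. -/
noncomputable abbrev copowerCounit : (∐ fun _ : G => 𝟙_ E) ⟶ 𝟙_ E :=
  Sigma.desc fun _ => 𝟙 (𝟙_ E)

theorem copowerι_counit (X : E) (σ : G) :
    copowerι X σ ≫ X ◁ copowerCounit E G = (ρ_ X).inv := by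
  rw [Category.assoc, ← whiskerLeft_comp, Sigma.ι_desc, whiskerLeft_id, Category.comp_id]

instance (σ : G) : Mono (copowerι X σ) :=
  mono_of_mono_fac (copowerι_counit X σ)

variable {δ} [FinitaryPreExtensive E]

instance (σ : G) : Mono (partι δ σ) :=
  inferInstanceAs (Mono (pullback.fst δ (copowerι X σ)))

instance isIso_desc_partι : IsIso (Sigma.desc fun σ => partι δ σ) :=
  FinitaryPreExtensive.isIso_sigmaDesc_fst (copowerι X) δ
    ((Cofan.nonempty_isColimit_iff_isIso_sigmaDesc _).1 ⟨copowerColim G X⟩)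

/-- Counitality forces the two projections of the pullback which defines the homogeneous part to
agree. -/
theorem isHomogeneous_partι (hδ : δ ≫ X ◁ copowerCounit E G = (ρ_ X).inv) (σ : G) :
    IsHomogeneous δ σ (partι δ σ) := by
  have h : pullback.fst δ (copowerι X σ) ≫ δ = pullback.snd δ (copowerι X σ) ≫ copowerι X σ :=
    pullback.condition
  have e : pullback.fst δ (copowerι X σ) = pullback.snd δ (copowerι X σ) := by
    rw [← cancel_mono (ρ_ X).inv]
    exact (congrArg (_ ≫ ·) hδ.symm).trans <| (Category.assoc _ _ _).symm.trans <|
      (congrArg (· ≫ _) h).trans <| (Category.assoc _ _ _).trans <|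
        congrArg (_ ≫ ·) (copowerι_counit X σ)
  rw [isHomogeneous_iff]
  exact h.trans (congrArg (· ≫ _) e.symm)

/-- A homogeneous morphism factors through the homogeneous part of its degree. -/
noncomputable def IsHomogeneous.lift {σ : G} {g : Z ⟶ X} (hg : IsHomogeneous δ σ g) :
    Z ⟶ part δ σ :=
  pullback.lift g g (isHomogeneous_iff.1 hg)

theorem IsHomogeneous.lift_partι {σ : G} {g : Z ⟶ X} (hg : IsHomogeneous δ σ g) :
    hg.lift ≫ partι δ σ = g :=
  pullback.lift_fst _ _ _

end Homogeneous
end ColouredOperad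

/-! ### Full faithfulness of the symmetrisation -/

namespace ColouredOperad

/-- A tuple `c` with a colour-preserving bijection `σ` to `e` is the permuted tuple `e^σ`. -/
theorem Tuple.perm_induction {C : Type w}
    {motive : ∀ (c e : Tuple C) (σ : Fin c.len ≃ Fin e.len),
      (∀ p, e.col (σ p) = c.col p) → Prop}
    (H : ∀ (e : Tuple C) (σ : Equiv.Perm (Fin e.len)), motive (e.perm σ) e σ fun _ => rfl)
    (c e : Tuple C) (σ : Fin c.len ≃ Fin e.len) (h : ∀ p, e.col (σ p) = c.col p) :
    motive c e σ h := by
  obtain ⟨n, c⟩ := c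
  obtain ⟨m, e⟩ := e
  obtain rfl : n = m := Tuple.len_eq_of_equiv σ
  revert σ
  intro (σ : Equiv.Perm (Fin n)) (h : ∀ p, e (σ p) = c p)
  obtain rfl : c = fun p => e (σ p) := funext fun p => (h p).symm
  exact H ⟨n, e⟩ σ

theorem blockPerm_refl {n m : ℕ} (i : Fin n) (p : Fin (n + m - 1)) :
    blockPerm (Equiv.refl (Fin n)) i (Equiv.refl (Fin m)) p = p := by
  revert p
  refine slot_cases i (fun j h => ?_) (fun k => ?_)
  · rw [blockPerm_outer]; rfl
  · rw [blockPerm_inner]; rfl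

variable {E : Type u} [Category.{v} E] [MonoidalCategory E] [SymmetricCategory E]
  [HasFiniteCoproducts E] [∀ X : E, PreservesFiniteCoproducts (tensorLeft X)]

/-- The equality of the components is heterogeneous, as their types depend on the map of colours. -/
theorem Operad.Hom.app_heq {P Q : Operad.{w} E} {f g : P ⟶ Q} (h : f = g) (c : Tuple P.Col)
    (x : P.Col) : HEq (f.app c x) (g.app c x) := by
  rw [h]

namespace PlanarOperad

variable (P : PlanarOperad.{w} E)

/-- The inclusion of `P(c; x)` in `P_S(c; x)` as the summand indexed by the identity. -/
noncomputable abbrev inclOne (c : Tuple P.Col) (x : P.Col) : P.obj c x ⟶ P.symmObj c x :=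
  P.incl (c := c) (e := c) (Equiv.refl _) fun _ => rfl

theorem inclOne_eq_ι (c : Tuple P.Col) (x : P.Col) :
    P.inclOne c x = Sigma.ι (fun τ : Equiv.Perm (Fin c.len) => P.obj (c.perm τ⁻¹) x) 1 :=
  (P.ι_eq_incl 1).symm

theorem inclOne_circ {c : Tuple P.Col} {x : P.Col} {c' : Tuple P.Col} {y : P.Col}
    {d : Tuple P.Col} (i : Fin c.len) (hy : c.col i = y) (hd : c.insert i c' = d) :
    (P.inclOne c x ⊗ₘ P.inclOne c' y) ≫ P.symmCirc i hy hd =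
      P.circ i hy hd ≫ P.inclOne d x := by
  refine P.incl_symmCirc i hy hd (e := c) (e' := c') _ _ _ _ hy hd (Equiv.refl _)
    (fun p q h => ?_) _
  rw [blockPerm_refl]
  exact h

theorem inclOne_act (e : Tuple P.Col) (x : P.Col) (σ : Equiv.Perm (Fin e.len)) :
    P.inclOne e x ≫ P.symmAct σ (rfl : e.perm σ = _) =
      P.incl (c := e.perm σ) σ fun _ => rfl :=
  P.incl_symmAct σ rfl _ _ _ (fun p q h => by obtain rfl := Fin.ext h; rfl) _

instance [BinaryCoproductsDisjoint E] (c : Tuple P.Col) (x : P.Col) : Mono (P.inclOne c x) := by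
  have := monoCoprod_of_disjoint (E := E)
  rw [inclOne_eq_ι]
  exact MonoCoprod.mono_ι (fun τ : Equiv.Perm (Fin c.len) => P.obj (c.perm τ⁻¹) x) 1

theorem isHomogeneous_ι (c : Tuple P.Col) (x : P.Col) (σ : Equiv.Perm (Fin c.len)) :
    IsHomogeneous (P.coactApp c x) σ
      (Sigma.ι (fun τ : Equiv.Perm (Fin c.len) => P.obj (c.perm τ⁻¹) x) σ) :=
  Sigma.ι_desc _ _

theorem isHomogeneous_inclOne (c : Tuple P.Col) (x : P.Col) :
    IsHomogeneous (P.coactApp c x) (1 : Equiv.Perm (Fin c.len)) (P.inclOne c x) := by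
  rw [inclOne_eq_ι]
  exact P.isHomogeneous_ι c x 1

theorem exists_lift_inclOne [FinitaryPreExtensive E] [BinaryCoproductsDisjoint E]
    {c : Tuple P.Col} {x : P.Col} {Z : E} {g : Z ⟶ P.symmObj c x}
    (hg : IsHomogeneous (P.coactApp c x) (1 : Equiv.Perm (Fin c.len)) g) :
    ∃ k : Z ⟶ P.obj c x, k ≫ P.inclOne c x = g := by
  have : IsIso (Sigma.desc (Sigma.ι fun τ : Equiv.Perm (Fin c.len) => P.obj (c.perm τ⁻¹) x)) := by
    rw [show Sigma.desc (Sigma.ι fun τ : Equiv.Perm (Fin c.len) => P.obj (c.perm τ⁻¹) x) = 𝟙 _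
      from Sigma.hom_ext _ _ fun σ => by rw [Sigma.ι_desc, Category.comp_id]]
    infer_instance
  rw [inclOne_eq_ι]
  exact hg.exists_lift this (P.isHomogeneous_ι c x)

/-- A morphism out of a symmetrisation is determined by its restriction to the summands indexed
by the identities, since the symmetric groups permute the summands transitively. -/
theorem symm_app_ext {P : PlanarOperad.{w} E} {M : Operad.{w} E} {onCol : P.Col → M.Col}
    {f g : ∀ (c : Tuple P.Col) (x : P.Col), P.symmObj c x ⟶ M.obj (c.map onCol) (onCol x)}
    (hf : ∀ c x (σ : Equiv.Perm (Fin c.len)), P.symmAct σ (rfl : c.perm σ = _) ≫ f (c.perm σ) x =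
      f c x ≫ M.act (c := c.map onCol) σ rfl)
    (hg : ∀ c x (σ : Equiv.Perm (Fin c.len)), P.symmAct σ (rfl : c.perm σ = _) ≫ g (c.perm σ) x =
      g c x ≫ M.act (c := c.map onCol) σ rfl)
    (h : ∀ c x, P.inclOne c x ≫ f c x = P.inclOne c x ≫ g c x) : f = g := by
  funext c x
  refine P.symm_hom_ext fun e σ hσ => ?_
  induction c, e, σ, hσ using Tuple.perm_induction with
  | H e σ =>
    rw [← inclOne_act, Category.assoc, Category.assoc]
    refine (congrArg (_ ≫ ·) (hf e x σ)).trans (.trans ?_ (congrArg (_ ≫ ·) (hg e x σ)).symm)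
    rw [← Category.assoc, h, Category.assoc]

/-- A morphism of planar operads is the restriction of its symmetrisation to the summands indexed by
the identities. -/
theorem symmMap_injective [BinaryCoproductsDisjoint E] {P Q : PlanarOperad.{w} E} {f g : P ⟶ Q}
    (h : symmMap f = symmMap g) : f = g := by
  have hcol : f.onCol = g.onCol := congrArg (fun F => F.onCol) h
  have happ := fun c x => Operad.Hom.app_heq h c x
  obtain ⟨fo, fa, f1, fc⟩ := f
  obtain ⟨go, ga, g1, gc⟩ := g
  obtain rfl : fo = go := hcol
  refine Hom.ext rfl (heq_of_eq ?_)
  funext c x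
  rw [← cancel_mono (Q.inclOne (c.map fo) (fo x))]
  have e₁ := incl_symmMapApp (P := P) (Q := Q) ⟨fo, fa, f1, fc⟩ (c := c) (e := c) (x := x)
    (Equiv.refl _) fun _ => rfl
  have e₂ := incl_symmMapApp (P := P) (Q := Q) ⟨fo, ga, g1, gc⟩ (c := c) (e := c) (x := x)
    (Equiv.refl _) fun _ => rfl
  exact e₁.symm.trans ((congrArg (_ ≫ ·) (eq_of_heq (happ c x))).trans e₂)

/-- A morphism of operads `P_S ⟶ Q_S` which commutes with the coactions preserves the summands
indexed by the identities, hence comes from a morphism of planar operads. -/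
theorem exists_symmMap_eq [FinitaryPreExtensive E] [BinaryCoproductsDisjoint E]
    {P Q : PlanarOperad.{w} E} (φ : P.symm ⟶ Q.symm)
    (hφ : φ ≫ Q.coaction = P.coaction ≫ φ ▷ uAs.{w} E) : ∃ f : P ⟶ Q, symmMap f = φ := by
  have hφ' : ∀ c x, φ.app c x ≫ Q.coactApp (c.map φ.onCol) (φ.onCol x) =
      P.coactApp c x ≫ (φ.app c x ⊗ₘ 𝟙 _) := fun c x =>
    eq_of_heq (Operad.Hom.app_heq hφ c x)
  have hk : ∀ c x, ∃ k : P.obj c x ⟶ Q.obj (c.map φ.onCol) (φ.onCol x),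
      k ≫ Q.inclOne _ _ = P.inclOne c x ≫ φ.app c x := fun c x => by
    refine Q.exists_lift_inclOne ?_
    rw [IsHomogeneous, Category.assoc, hφ', ← Category.assoc, P.isHomogeneous_inclOne c x,
      Category.assoc, tensorHom_comp_tensorHom, Category.comp_id]
  choose k hk using hk
  let f : P ⟶ Q :=
    { onCol := φ.onCol
      app := k
      one_app := fun x => by
        rw [← cancel_mono (Q.inclOne _ _), Category.assoc, hk, ← Category.assoc]
        exact φ.one_app x
      circ_app := fun c x c' y i hy => by
        rw [← cancel_mono (Q.inclOne _ _), Category.assoc, hk, ← Category.assoc, ← inclOne_circ,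
          Category.assoc, Category.assoc]
        refine (congrArg (_ ≫ ·) (φ.circ_app c x c' y i hy)).trans ?_
        rw [tensorHom_comp_tensorHom_assoc, ← hk, ← hk, ← tensorHom_comp_tensorHom,
          Category.assoc]
        exact congrArg (_ ≫ ·) (Q.inclOne_circ (c := c.map φ.onCol) (c' := c'.map φ.onCol) i _ _) }
  refine ⟨f, Operad.Hom.ext_app rfl (heq_of_eq ?_)⟩
  refine symm_app_ext (P := P) (M := Q.symm) (onCol := φ.onCol) (symmMap_act f) φ.act_app
    fun c x => ?_
  exact (incl_symmMapApp f (c := c) (e := c) _ _).trans (hk c x)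

end PlanarOperad
end ColouredOperad

/-! ### Essential surjectivity of the symmetrisation -/

namespace ColouredOperad

variable {E : Type u} [Category.{v} E] [MonoidalCategory E] [SymmetricCategory E]
  [HasFiniteCoproducts E] [∀ X : E, PreservesFiniteCoproducts (tensorLeft X)]

/-- The actions of a permutation and of its inverse are inverse to each other. The colours are only
propositionally restored, whence the heterogeneous equality. -/
theorem Operad.act_act_of_heq_inv (M : Operad.{w} E) {c d : Tuple M.Col} {x : M.Col}
    (σ : Equiv.Perm (Fin c.len)) (hd : c.perm σ = d) (τ : Equiv.Perm (Fin d.len))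
    (hc : d.perm τ = c) (h : HEq τ σ⁻¹) : M.act (x := x) σ hd ≫ M.act τ hc = 𝟙 _ := by
  subst hd
  obtain rfl := eq_of_heq h
  have e : ∀ (μ : Equiv.Perm (Fin c.len)) (hμ : c.perm μ = c), μ = 1 →
      M.act (x := x) μ hμ = 𝟙 _ := by
    rintro _ _ rfl
    exact M.act_one c x
  have e' : ∀ (f : Tuple M.Col) (hf : (c.perm σ).perm σ⁻¹ = f),
      M.act (x := x) σ (rfl : c.perm σ = _) ≫ M.act (c := c.perm σ) σ⁻¹ hf =
        M.act (σ * σ⁻¹) hf := by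
    rintro _ rfl
    exact M.act_act c x σ σ⁻¹
  exact (e' c hc).trans (e _ hc (mul_inv_cancel σ))

theorem rightUnitor_inv_tensorμ {X Y Z W : E} (p : X ⊗ Y ⟶ Z) (q : 𝟙_ E ⟶ W) :
    ((ρ_ X).inv ⊗ₘ (ρ_ Y).inv) ≫ tensorμ X (𝟙_ E) Y (𝟙_ E) ≫ (p ⊗ₘ ((λ_ (𝟙_ E)).hom ≫ q)) =
      (ρ_ (X ⊗ Y)).inv ≫ (p ⊗ₘ q) := by
  have h := PlanarOperad.rightUnitor_inv_circ (𝟙 (X ⊗ Y))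
  rw [Category.id_comp] at h
  rw [← h, Category.assoc, Category.assoc, tensorHom_comp_tensorHom, Category.id_comp]

/-- A counital morphism of operads `M ⟶ M ⊗ uAs`, normalised so that it is the identity on the
colours of `M`. -/
structure UAsCoaction (M : Operad.{w} E) where
  app : ∀ (c : Tuple M.Col) (x : M.Col), M.obj c x ⟶ M.obj c x ⊗
    (PlanarOperad.planarUAs.{w} E).symmObj (c.map fun _ => PUnit.unit) PUnit.unit
  app_counit : ∀ (c : Tuple M.Col) (x : M.Col),
    app c x ≫ M.obj c x ◁ copowerCounit E (Equiv.Perm (Fin c.len)) = (ρ_ _).inv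
  one_app : ∀ x : M.Col, M.one x ≫ app (Tuple.single x) x =
    (λ_ (𝟙_ E)).inv ≫ (M.one x ⊗ₘ (PlanarOperad.planarUAs.{w} E).symmOne PUnit.unit)
  circ_app : ∀ (c : Tuple M.Col) (x : M.Col) (c' : Tuple M.Col) (y : M.Col) (i : Fin c.len)
    (hy : c.col i = y), M.circ i hy (rfl : c.insert i c' = _) ≫ app (c.insert i c') x =
      (app c x ⊗ₘ app c' y) ≫ tensorμ _ _ _ _ ≫ (M.circ i hy (rfl : c.insert i c' = _) ⊗ₘ
        (PlanarOperad.planarUAs.{w} E).symmCirc (x := PUnit.unit) (y := PUnit.unit)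
          (c := c.map fun _ => PUnit.unit) (c' := c'.map fun _ => PUnit.unit)
          (d := (c.insert i c').map fun _ => PUnit.unit) i rfl (Tuple.map_insert _ c i c'))
  act_app : ∀ (c : Tuple M.Col) (x : M.Col) (μ : Equiv.Perm (Fin c.len)),
    M.act μ (rfl : c.perm μ = _) ≫ app (c.perm μ) x =
      app c x ≫ (M.act μ (rfl : c.perm μ = _) ⊗ₘ
        (PlanarOperad.planarUAs.{w} E).symmAct (x := PUnit.unit)
          (c := c.map fun _ => PUnit.unit) μ rfl)

namespace UAsCoaction

/-- The morphism of operads underlying a coaction. -/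
def hom {M : Operad.{w} E} (δ : UAsCoaction M) : M ⟶ M ⊗ PlanarOperad.uAs.{w} E where
  onCol x := (x, PUnit.unit)
  app := δ.app
  one_app := δ.one_app
  circ_app := δ.circ_app
  act_app := δ.act_app

/-- Counitality forces a coaction to be the identity on the colours of the comodule. -/
theorem exists_hom_eq {M : Operad.{w} E} (f : M ⟶ M ⊗ PlanarOperad.uAs.{w} E)
    (hf : f ≫ M ◁ ComonObj.counit = (ρ_ M).inv) : ∃ δ : UAsCoaction M, δ.hom = f := by
  have hcol : f.onCol = fun x => (x, PUnit.unit) :=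
    funext fun x => Prod.ext (congrArg (fun F => (F.onCol x).1) hf) rfl
  have happ := fun c x => Operad.Hom.app_heq hf c x
  obtain ⟨⟨onCol, app, one, circ⟩, act⟩ := f
  obtain rfl : onCol = fun x => (x, PUnit.unit) := hcol
  refine ⟨⟨app, fun c x => ?_, one, circ, act⟩, rfl⟩
  rw [← id_tensorHom]
  exact eq_of_heq (happ c x)

variable {M : Operad.{w} E} (δ : UAsCoaction M)

theorem isHomogeneous_one (x : M.Col) :
    IsHomogeneous (δ.app (Tuple.single x) x) (1 : Equiv.Perm (Fin 1)) (M.one x) := by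
  rw [IsHomogeneous]
  refine (δ.one_app x).trans ?_
  rw [unitors_inv_equal]
  congr 2
  refine (Category.id_comp _).trans ?_
  exact (PlanarOperad.planarUAs.{w} E).inclOne_eq_ι (Tuple.single PUnit.unit) PUnit.unit

theorem isHomogeneous_circ {c : Tuple M.Col} {x : M.Col} {c' : Tuple M.Col} {y : M.Col}
    {d : Tuple M.Col} (i : Fin c.len) (hy : c.col i = y) (hd : c.insert i c' = d) {Y Z : E}
    {f : Y ⟶ M.obj c x} {g : Z ⟶ M.obj c' y}
    (hf : IsHomogeneous (δ.app c x) (1 : Equiv.Perm (Fin c.len)) f)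
    (hg : IsHomogeneous (δ.app c' y) (1 : Equiv.Perm (Fin c'.len)) g) :
    IsHomogeneous (δ.app d x) (1 : Equiv.Perm (Fin d.len)) ((f ⊗ₘ g) ≫ M.circ i hy hd) := by
  subst hd
  have e := (PlanarOperad.planarUAs.{w} E).inclOne_circ (x := PUnit.unit) (y := PUnit.unit)
    (c := c.map fun _ => PUnit.unit) (c' := c'.map fun _ => PUnit.unit)
    (d := (c.insert i c').map fun _ => PUnit.unit) i rfl (Tuple.map_insert _ c i c')
  rw [PlanarOperad.inclOne_eq_ι, PlanarOperad.inclOne_eq_ι, PlanarOperad.inclOne_eq_ι] at e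
  rw [IsHomogeneous] at *
  rw [Category.assoc, δ.circ_app, tensorHom_comp_tensorHom_assoc, hf, hg,
    ← tensorHom_comp_tensorHom, Category.assoc, tensorμ_natural_assoc, tensorHom_comp_tensorHom]
  refine (congrArg (fun t => _ ≫ _ ≫ (_ ⊗ₘ t)) e).trans ?_
  exact rightUnitor_inv_tensorμ _ _

theorem isHomogeneous_act {c : Tuple M.Col} {x : M.Col} {d : Tuple M.Col}
    (μ : Equiv.Perm (Fin c.len)) (hd : c.perm μ = d) (σ : Equiv.Perm (Fin c.len))
    (τ : Equiv.Perm (Fin d.len))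
    (hτ : ∀ (p : Fin d.len) (q : Fin c.len), (p : ℕ) = q → (τ p : ℕ) = σ (μ q)) {Z : E}
    {f : Z ⟶ M.obj c x} (hf : IsHomogeneous (δ.app c x) σ f) :
    IsHomogeneous (δ.app d x) τ (f ≫ M.act μ hd) := by
  subst hd
  have e := (PlanarOperad.planarUAs.{w} E).incl_symmAct (x := PUnit.unit)
    (c := c.map fun _ => PUnit.unit) (e := c.map fun _ => PUnit.unit) μ rfl σ (fun _ => rfl) τ hτ
    (fun _ => rfl)
  have e₁ := (PlanarOperad.planarUAs.{w} E).ι_eq_incl (x := PUnit.unit)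
    (c := c.map fun _ => PUnit.unit) σ
  have e₂ := (PlanarOperad.planarUAs.{w} E).ι_eq_incl (x := PUnit.unit)
    (c := (c.perm μ).map fun _ => PUnit.unit) τ
  have e' := (congrArg (· ≫ _) e₁).trans (e.trans e₂.symm)
  rw [IsHomogeneous] at *
  rw [Category.assoc, δ.act_app, ← Category.assoc, hf, Category.assoc, tensorHom_comp_tensorHom]
  exact congrArg (fun t => _ ≫ (_ ⊗ₘ t)) e'

variable [FinitaryPreExtensive E]

/-- The inclusion in `M(c; x)` of its homogeneous part of degree `1`. -/
noncomputable abbrev ι (c : Tuple M.Col) (x : M.Col) :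
    part (δ.app c x) (1 : Equiv.Perm (Fin c.len)) ⟶ M.obj c x :=
  partι (δ.app c x) (1 : Equiv.Perm (Fin c.len))

theorem isHomogeneous_ι (c : Tuple M.Col) (x : M.Col) :
    IsHomogeneous (δ.app c x) (1 : Equiv.Perm (Fin c.len)) (δ.ι c x) :=
  isHomogeneous_partι (δ.app_counit c x) 1

/-- The composition of the homogeneous parts of degree `1`. -/
noncomputable def partCirc {c : Tuple M.Col} {x : M.Col} {c' : Tuple M.Col} {y : M.Col}
    {d : Tuple M.Col} (i : Fin c.len) (hy : c.col i = y) (hd : c.insert i c' = d) :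
    part (δ.app c x) (1 : Equiv.Perm (Fin c.len)) ⊗
      part (δ.app c' y) (1 : Equiv.Perm (Fin c'.len)) ⟶
        part (δ.app d x) (1 : Equiv.Perm (Fin d.len)) :=
  (δ.isHomogeneous_circ i hy hd (δ.isHomogeneous_ι c x) (δ.isHomogeneous_ι c' y)).lift

theorem partCirc_ι {c : Tuple M.Col} {x : M.Col} {c' : Tuple M.Col} {y : M.Col}
    {d : Tuple M.Col} (i : Fin c.len) (hy : c.col i = y) (hd : c.insert i c' = d) :
    δ.partCirc (x := x) i hy hd ≫ δ.ι d x = (δ.ι c x ⊗ₘ δ.ι c' y) ≫ M.circ i hy hd :=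
  IsHomogeneous.lift_partι _

/-- The units of `M`, as morphisms into the homogeneous parts of degree `1`. -/
noncomputable def partOne (x : M.Col) :
    𝟙_ E ⟶ part (δ.app (Tuple.single x) x) (1 : Equiv.Perm (Fin 1)) :=
  (δ.isHomogeneous_one x).lift

theorem partOne_ι (x : M.Col) : δ.partOne x ≫ δ.ι (Tuple.single x) x = M.one x :=
  IsHomogeneous.lift_partι _

/-- An iterated composition of homogeneous operations of degree `1` is computed in `M`. -/
theorem partCirc_partCirc_ι {c c' c'' d e : Tuple M.Col} {x y z : M.Col} (i : Fin c.len)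
    (hy : c.col i = y) (he : c.insert i c' = e) (p : Fin e.len) (hz : e.col p = z)
    (hd : e.insert p c'' = d) :
    δ.partCirc (x := x) i hy he ▷ part (δ.app c'' z) (1 : Equiv.Perm (Fin c''.len)) ≫
        δ.partCirc p hz hd ≫ δ.ι d x =
      ((δ.ι c x ⊗ₘ δ.ι c' y) ⊗ₘ δ.ι c'' z) ≫
        M.circ (x := x) i hy he ▷ M.obj c'' z ≫ M.circ p hz hd := by
  rw [partCirc_ι, whiskerRight_comp_tensorHom_assoc, partCirc_ι,
    tensorHom_comp_whiskerRight_assoc]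

/-- The planar operad formed by the homogeneous parts of degree `1`. -/
noncomputable abbrev planarPart : PlanarOperad.{w} E where
  Col := M.Col
  obj c x := part (δ.app c x) (1 : Equiv.Perm (Fin c.len))
  circ i hy hd := δ.partCirc i hy hd
  one := δ.partOne
  one_circ c x := by
    rw [← cancel_mono (δ.ι c x), Category.assoc, partCirc_ι, whiskerRight_comp_tensorHom_assoc,
      partOne_ι, ← leftUnitor_naturality, ← M.one_circ, ← Category.assoc,
      ← MonoidalCategory.tensorHom_def']
  circ_one c x i y hy := by
    rw [← cancel_mono (δ.ι c x), Category.assoc, partCirc_ι, whiskerLeft_comp_tensorHom_assoc,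
      partOne_ι, ← rightUnitor_naturality, ← M.circ_one c x i y hy, ← Category.assoc,
      ← MonoidalCategory.tensorHom_def]
  circ_circ_inner c x c' y c'' z d i hy j hz hd := by
    rw [← cancel_mono (δ.ι d x), Category.assoc, partCirc_partCirc_ι, M.circ_circ_inner,
      associator_naturality_assoc, Category.assoc, Category.assoc, partCirc_ι,
      tensorHom_comp_whiskerLeft_assoc, whiskerLeft_comp_tensorHom_assoc, partCirc_ι]
  circ_circ_outer c x c' y c'' z d i k h hy hz hd := by
    rw [← cancel_mono (δ.ι d x), Category.assoc, partCirc_partCirc_ι,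
      M.circ_circ_outer c x c' y c'' z d i k h hy hz hd,
      associator_naturality_assoc, tensorHom_comp_whiskerLeft_assoc,
      BraidedCategory.braiding_naturality, ← whiskerLeft_comp_tensorHom_assoc,
      associator_inv_naturality_assoc,
      ← partCirc_partCirc_ι δ k hz rfl (outer k c''.len i h.symm)
        ((Tuple.insert_col_outer c k c'' i h.symm).trans hy) hd]
    simp only [Category.assoc]

/-- The components of the morphism from the symmetrisation of the part of degree `1` to `M`: on the
summand indexed by `σ` it is the action `σ^* : M(c^{σ⁻¹}; x) ⟶ M(c; x)`. -/
noncomputable def fromSymmApp (c : Tuple M.Col) (x : M.Col) :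
    δ.planarPart.symmObj c x ⟶ M.obj c x :=
  Sigma.desc fun σ => δ.ι (c.perm σ⁻¹) x ≫
    M.act (c := c.perm σ⁻¹) σ (congrArg (Tuple.mk c.len) (funext fun p =>
      congrArg c.col (σ.symm_apply_apply p)))

theorem incl_fromSymmApp (e : Tuple M.Col) (x : M.Col) (σ : Equiv.Perm (Fin e.len))
    {c : Tuple M.Col} (hc : e.perm σ = c) (τ : Fin c.len ≃ Fin e.len)
    (hτ : ∀ (p : Fin c.len) (q : Fin e.len), (p : ℕ) = q → (τ p : ℕ) = σ q)
    (h : ∀ p, e.col (τ p) = c.col p) :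
    δ.planarPart.incl τ h ≫ δ.fromSymmApp c x = δ.ι e x ≫ M.act σ hc := by
  obtain ⟨τ', rfl, h'⟩ := δ.planarPart.incl_eq_ι τ h
  obtain rfl := (eq_of_heq h').symm
  rw [← PlanarOperad.ι_eq_incl, fromSymmApp, Sigma.ι_desc]
  obtain rfl : τ' = σ := Equiv.ext fun p => Fin.ext (hτ p p rfl)
  rfl

theorem inclOne_fromSymmApp (c : Tuple M.Col) (x : M.Col) :
    δ.planarPart.inclOne c x ≫ δ.fromSymmApp c x = δ.ι c x := by
  refine (δ.incl_fromSymmApp c x 1 rfl _ (fun p q h => h) _).trans ?_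
  exact (congrArg (_ ≫ ·) (M.act_one c x)).trans (Category.comp_id _)

theorem fromSymmApp_circ (c : Tuple M.Col) (x : M.Col) (c' : Tuple M.Col) (y : M.Col)
    (i : Fin c.len) (hy : c.col i = y) :
    δ.planarPart.symmCirc i hy (rfl : c.insert i c' = _) ≫ δ.fromSymmApp (c.insert i c') x =
      (δ.fromSymmApp c x ⊗ₘ δ.fromSymmApp c' y) ≫ M.circ i hy rfl := by
  refine δ.planarPart.symm_hom_ext₂ fun e e' σ hσ μ hμ => ?_
  induction c, e, σ, hσ using Tuple.perm_induction with
  | H e σ =>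
    induction c', e', μ, hμ using Tuple.perm_induction with
    | H e' μ =>
      have h := Tuple.perm_insert e σ i e' μ
      have h₁ := δ.planarPart.incl_symmCirc (x := x) (c := e.perm σ) (c' := e'.perm μ) i hy rfl
        (e := e) (e' := e') σ (fun _ => rfl) μ (fun _ => rfl) hy rfl (blockPerm σ i μ)
        (fun p q h => by obtain rfl := Fin.ext h; rfl)
        (PlanarOperad.blockPerm_col (c := e.perm σ) (c' := e'.perm μ) σ (fun _ => rfl) i μ
          (fun _ => rfl))
      rw [← Category.assoc, h₁, Category.assoc]
      have h₂ := δ.incl_fromSymmApp (e.insert (σ i) e') x (blockPerm σ i μ) h.symm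
        (blockPerm σ i μ) (fun p q h => by obtain rfl := Fin.ext h; rfl)
        (PlanarOperad.blockPerm_col (c := e.perm σ) (c' := e'.perm μ) σ (fun _ => rfl) i μ
          (fun _ => rfl))
      refine (congrArg (_ ≫ ·) h₂).trans ?_
      rw [tensorHom_comp_tensorHom_assoc,
        δ.incl_fromSymmApp e x σ rfl σ (fun p q h => by obtain rfl := Fin.ext h; rfl),
        δ.incl_fromSymmApp e' y μ rfl μ (fun p q h => by obtain rfl := Fin.ext h; rfl),
        ← tensorHom_comp_tensorHom, Category.assoc,
        M.act_circ' σ μ i hy rfl rfl (blockPerm σ i μ) HEq.rfl h.symm]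
      refine (Category.assoc _ _ _).symm.trans (.trans ?_ (Category.assoc _ _ _))
      exact congrArg (· ≫ _) (δ.partCirc_ι (x := x) (c := e) (c' := e') (σ i) hy rfl)

theorem fromSymmApp_act (c : Tuple M.Col) (x : M.Col) (μ : Equiv.Perm (Fin c.len)) :
    δ.planarPart.symmAct μ (rfl : c.perm μ = _) ≫ δ.fromSymmApp (c.perm μ) x =
      δ.fromSymmApp c x ≫ M.act μ rfl := by
  refine δ.planarPart.symm_hom_ext fun e σ hσ => ?_
  induction c, e, σ, hσ using Tuple.perm_induction with
  | H e σ =>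
    have h₁ := δ.planarPart.incl_symmAct (x := x) (c := e.perm σ) (e := e) μ rfl σ (fun _ => rfl)
      (μ.trans σ) (fun p q h => by obtain rfl := Fin.ext h; rfl) (fun _ => rfl)
    have h₂ := δ.incl_fromSymmApp e x σ rfl σ (fun p q h => by obtain rfl := Fin.ext h; rfl)
      (fun _ => rfl)
    have h₃ := δ.incl_fromSymmApp e x (σ * μ) (rfl : _ = (e.perm σ).perm μ) (μ.trans σ)
      (fun p q h => by obtain rfl := Fin.ext h; rfl) (fun _ => rfl)
    rw [← Category.assoc, ← Category.assoc, h₂, h₁, Category.assoc]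
    exact h₃.trans (congrArg (_ ≫ ·) (M.act_act e x σ μ).symm)

/-- The comparison morphism of operads `(M₁)_S ⟶ M`, for the part `M₁` of degree `1` of `M`. -/
noncomputable def fromSymm : δ.planarPart.symm ⟶ M where
  onCol x := x
  app := δ.fromSymmApp
  one_app x := by
    refine (Category.assoc _ _ _).trans ?_
    exact (congrArg (_ ≫ ·) (δ.inclOne_fromSymmApp (Tuple.single x) x)).trans (δ.partOne_ι x)
  circ_app := δ.fromSymmApp_circ
  act_app := δ.fromSymmApp_act

theorem isHomogeneous_act_ι (c : Tuple M.Col) (x : M.Col) (σ : Equiv.Perm (Fin c.len))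
    (h : (c.perm σ⁻¹).perm σ = c) :
    IsHomogeneous (δ.app c x) σ (δ.ι (c.perm σ⁻¹) x ≫ M.act (c := c.perm σ⁻¹) σ h) :=
  δ.isHomogeneous_act (c := c.perm σ⁻¹) σ h 1 σ (fun p q h => by obtain rfl := Fin.ext h; rfl)
    (δ.isHomogeneous_ι _ x)

theorem fromSymm_hom : δ.fromSymm ≫ δ.hom =
    δ.planarPart.coaction ≫ δ.fromSymm ▷ PlanarOperad.uAs.{w} E := by
  refine Operad.Hom.ext_app rfl (heq_of_eq ?_)
  funext c x
  change δ.fromSymmApp c x ≫ δ.app c x =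
    δ.planarPart.coactApp c x ≫ (δ.fromSymmApp c x ⊗ₘ 𝟙 _)
  refine Sigma.hom_ext _ _ fun σ => ?_
  have e := δ.planarPart.isHomogeneous_ι c x σ
  rw [IsHomogeneous] at e
  refine .trans ?_ (Category.assoc _ _ _)
  rw [e, Category.assoc, tensorHom_comp_tensorHom, Category.comp_id, ← Category.assoc, fromSymmApp,
    Sigma.ι_desc]
  exact δ.isHomogeneous_act_ι c x σ _

/-- The action of `σ⁻¹` carries the homogeneous part of degree `σ` to the one of degree `1`. -/
theorem isHomogeneous_partι_act (c : Tuple M.Col) (x : M.Col) (σ : Equiv.Perm (Fin c.len)) :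
    IsHomogeneous (δ.app (c.perm σ⁻¹) x) (1 : Equiv.Perm (Fin c.len))
      (partι (δ.app c x) σ ≫ M.act σ⁻¹ (rfl : c.perm σ⁻¹ = _)) :=
  δ.isHomogeneous_act σ⁻¹ rfl σ 1
    (fun p q h => by obtain rfl := Fin.ext h; exact congrArg Fin.val (σ.apply_symm_apply p).symm)
    (isHomogeneous_partι (δ.app_counit c x) σ)

/-- `M(c; x)` is the coproduct of its homogeneous parts, and the action of `σ⁻¹` identifies the
part of degree `σ` with the part of degree `1` of `M(c^{σ⁻¹}; x)`. -/
instance isIso_fromSymmApp (c : Tuple M.Col) (x : M.Col) : IsIso (δ.fromSymmApp c x) := by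
  have h : ∀ σ : Equiv.Perm (Fin c.len), (c.perm σ⁻¹).perm σ = c := fun σ =>
    congrArg (Tuple.mk c.len) (funext fun p => congrArg c.col (σ.symm_apply_apply p))
  let k : ∀ σ : Equiv.Perm (Fin c.len), part (δ.app c x) σ ⟶ δ.planarPart.obj (c.perm σ⁻¹) x :=
    fun σ => (δ.isHomogeneous_partι_act c x σ).lift
  have hk : ∀ σ, k σ ≫ δ.ι (c.perm σ⁻¹) x = partι (δ.app c x) σ ≫ M.act σ⁻¹ rfl := fun σ =>
    IsHomogeneous.lift_partι _
  let s : M.obj c x ⟶ δ.planarPart.symmObj c x :=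
    inv (Sigma.desc fun σ => partι (δ.app c x) σ) ≫ Sigma.desc fun σ => k σ ≫
      Sigma.ι (fun τ : Equiv.Perm (Fin c.len) => δ.planarPart.obj (c.perm τ⁻¹) x) σ
  have hs : ∀ σ, partι (δ.app c x) σ ≫ s = k σ ≫
      Sigma.ι (fun τ : Equiv.Perm (Fin c.len) => δ.planarPart.obj (c.perm τ⁻¹) x) σ := fun σ => by
    rw [← Sigma.ι_desc (fun σ => partι (δ.app c x) σ) σ, Category.assoc, IsIso.hom_inv_id_assoc,
      Sigma.ι_desc]
  have hf : ∀ σ, Sigma.ι (fun τ : Equiv.Perm (Fin c.len) => δ.planarPart.obj (c.perm τ⁻¹) x) σ ≫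
      δ.fromSymmApp c x = δ.ι (c.perm σ⁻¹) x ≫ M.act (c := c.perm σ⁻¹) σ (h σ) := fun σ =>
    Sigma.ι_desc _ _
  refine ⟨s, Sigma.hom_ext _ _ fun σ => ?_, ?_⟩
  · have hl := (δ.isHomogeneous_act_ι c x σ (h σ)).lift_partι
    have e₁ : M.act (x := x) (c := c.perm σ⁻¹) σ (h σ) ≫ M.act σ⁻¹ (rfl : c.perm σ⁻¹ = _) = 𝟙 _ :=
      M.act_act_of_heq_inv (c := c.perm σ⁻¹) _ _ _ _ HEq.rfl
    have e : (δ.isHomogeneous_act_ι c x σ (h σ)).lift ≫ k σ = 𝟙 _ := by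
      rw [← cancel_mono (δ.ι (c.perm σ⁻¹) x), Category.assoc, hk, ← Category.assoc, hl,
        Category.assoc, e₁, Category.comp_id, Category.id_comp]
    rw [← Category.assoc, hf, ← hl, Category.assoc, hs, ← Category.assoc, e, Category.id_comp,
      Category.comp_id]
  · rw [← cancel_epi (Sigma.desc fun σ => partι (δ.app c x) σ)]
    refine Sigma.hom_ext _ _ fun σ => ?_
    have e₁ : M.act (x := x) σ⁻¹ (rfl : c.perm σ⁻¹ = _) ≫ M.act (c := c.perm σ⁻¹) σ (h σ) = 𝟙 _ :=
      M.act_act_of_heq_inv _ _ _ _ (heq_of_eq (inv_inv σ).symm)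
    rw [Sigma.ι_desc_assoc, Category.comp_id, Sigma.ι_desc, ← Category.assoc, hs, Category.assoc,
      hf, ← Category.assoc, hk, Category.assoc, e₁, Category.comp_id]

/-- The inverse of the comparison morphism. -/
noncomputable def toSymm : M ⟶ δ.planarPart.symm where
  onCol x := x
  app c x := inv (δ.fromSymmApp c x)
  one_app x := (IsIso.comp_inv_eq _).2 (δ.fromSymm.one_app x).symm
  circ_app c x c' y i hy := Operad.circ_inv (asIso (δ.fromSymmApp c x))
    (asIso (δ.fromSymmApp c' y)) (asIso (δ.fromSymmApp (c.insert i c') x))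
    (δ.fromSymmApp_circ c x c' y i hy)
  act_app c x σ := by
    rw [IsIso.comp_inv_eq, Category.assoc, IsIso.eq_inv_comp]
    exact (δ.fromSymmApp_act c x σ).symm

theorem fromSymm_toSymm : δ.fromSymm ≫ δ.toSymm = 𝟙 _ := by
  refine Operad.Hom.ext_app rfl (heq_of_eq ?_)
  funext c x
  exact IsIso.hom_inv_id (δ.fromSymmApp c x)

theorem toSymm_fromSymm : δ.toSymm ≫ δ.fromSymm = 𝟙 _ := by
  refine Operad.Hom.ext_app rfl (heq_of_eq ?_)
  funext c x
  exact IsIso.inv_hom_id (δ.fromSymmApp c x)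

end UAsCoaction

/-- Every comodule is the symmetrisation of its part of degree `1`. -/
theorem exists_planarToComodule_iso [FinitaryPreExtensive E]
    (N : Comodule (PlanarOperad.uAs.{w} E)) :
    ∃ P : PlanarOperad.{w} E, Nonempty ((planarToComodule.{w} E).obj P ≅ N) := by
  obtain ⟨M, f, h₁, h₂⟩ := N
  obtain ⟨δ, rfl⟩ := UAsCoaction.exists_hom_eq f h₁
  refine ⟨δ.planarPart, ⟨⟨δ.fromSymm, δ.fromSymm_hom⟩, ⟨δ.toSymm, ?_⟩,
    Comodule.Hom.ext_hom δ.fromSymm_toSymm, Comodule.Hom.ext_hom δ.toSymm_fromSymm⟩⟩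
  have e : δ.fromSymm ≫ δ.toSymm ≫ δ.planarPart.coaction =
      δ.fromSymm ≫ δ.hom ≫ δ.toSymm ▷ PlanarOperad.uAs.{w} E := by
    rw [← Category.assoc, δ.fromSymm_toSymm, ← Category.assoc, δ.fromSymm_hom, Category.assoc,
      ← comp_whiskerRight, δ.fromSymm_toSymm, id_whiskerRight, Category.id_comp,
      Category.comp_id]
  have e' : δ.toSymm ≫ δ.planarPart.coaction = δ.hom ≫ δ.toSymm ▷ PlanarOperad.uAs.{w} E := by
    simpa only [← Category.assoc, δ.toSymm_fromSymm, Category.id_comp] using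
      congrArg (δ.toSymm ≫ ·) e
  exact e'

end ColouredOperad

theorem mainTheorem6 {E : Type u} [Category.{v} E] [MonoidalCategory E] [SymmetricCategory E]
    [HasFiniteCoproducts E] [∀ X : E, PreservesFiniteCoproducts (tensorLeft X)]
    [FinitaryPreExtensive E] [BinaryCoproductsDisjoint E] :
    (ColouredOperad.planarToComodule.{w} E).IsEquivalence where
  faithful := ⟨fun h => ColouredOperad.PlanarOperad.symmMap_injective (congrArg (·.hom) h)⟩
  full := ⟨fun φ => by
    obtain ⟨f, hf⟩ := ColouredOperad.PlanarOperad.exists_symmMap_eq φ.hom φ.hom_coact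
    exact ⟨f, ColouredOperad.Comodule.Hom.ext_hom hf⟩⟩
  essSurj := ⟨fun N => ColouredOperad.exists_planarToComodule_iso N⟩
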